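/- Let $M$ be a complex manifold (Hausdorff, second countable) of complex dimension at least $2$, with complex structure $I$ acting on $k$-forms by $(I\alpha)(v_1,\dots,v_k)=\alpha(Iv_1,\dots,Iv_k)$. For a smooth closed real $1$-form $\theta$ put $d_\theta\alpha:=d\alpha-\theta\wedge\alpha$ and $d^c_\theta:=I\,d_\theta\,I^{-1}$. An \emph{LCK form with Lee form} $\theta$ is a smooth real $(1,1)$-form $\omega$ on $M$ which is positive, i.e. $\omega(v,w)=g(v,Iw)$ for a Hermitian metric $g$ (equivalently $\omega(Iv,v)>0$ for all tangent vectors $v\neq 0$), and which satisfies $d\omega=\theta\wedge\omega$. A smooth real function $f$ on an open set $V\subset M$ is \emph{strictly $d_\theta d^c_\theta$-plurisubharmonic} on $V$ if the form $d_\theta d^c_\theta f$ is positive at every point of $V$. Let $\omega$ be an LCK form on $M$ with Lee form $\theta$ and associated Hermitian metric $g$. Let $D\subset M$ be a closed submanifold of the same dimension with smooth compact boundary $\partial D$ ($D$ itself need not be compact), let $V\supset D$ be an open neighbourhood of $D$, and let $\varphi,\psi$ be smooth strictly $d_\theta d^c_\theta$-plurisubharmonic functions on $V$ such that $\omega=d_\theta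 d^c_\theta\varphi$ on $V$ and $\psi=\varphi$ on $\partial D$. Let $X$ be a vector field along $\partial D$ (a section of $TM|_{\partial D}$) which at every point of $\partial D$ is outward-pointing and normal to $\partial D$ with respect to $g$, and assume that $\operatorname{Lie}_X\psi<\operatorname{Lie}_X\varphi$ everywhere on $\partial D$. Let $U$ be a neighbourhood of $\partial D$, let $D_-$ be an open subset of $M$ contained in $D$ and disjoint from $U$, and let $D_+$ be an open subset of $M$ contained in $M\setminus D$ and disjoint from $U$. Then there exists an LCK form $\omega_1$ on $M$, with the same Lee form $\theta$, such that $\omega_1=\omega$ on $D_+$ and $\omega_1=d_\theta d^c_\theta\psi$ on $D_-$. -/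

import Mathlib

open Set Filter Topology
open scoped Manifold ContDiff

noncomputable section

namespace LCK

variable {E : Type*} [NormedAddCommGroup E] [NormedSpace ℂ E]

section Pointwise

variable (E) in
/-- Multiplication by `i` on `E`, as a real linear map. On a complex manifold modelled on `E` it is
the complex structure operator `I` on each tangent space: transition maps being holomorphic, `I` is
multiplication by `i` in every chart. -/
def complexJ : E →L[ℝ] E :=
  (Complex.I • ContinuousLinearMap.id ℂ E).restrictScalars ℝ

/-- A real alternating `1`-form as a linear functional. -/
def toFunctional (a : E [⋀^Fin 1]→L[ℝ] ℝ) : E →L[ℝ] ℝ :=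
  (ContinuousAlternatingMap.ofSubsingleton ℝ E ℝ (0 : Fin 1)).symm a

/-- The wedge product `a ∧ b` of a `1`-form and a `k`-form:
`(a ∧ b)(v₀, …, v_k) = ∑ i, (-1)^i a(v_i) b(v₀, …, v̂_i, …, v_k)`. -/
def wedgeOne {k : ℕ} (a : E [⋀^Fin 1]→L[ℝ] ℝ) (b : E [⋀^Fin k]→L[ℝ] ℝ) :
    E [⋀^Fin (k + 1)]→L[ℝ] ℝ :=
  ContinuousAlternatingMap.alternatizeUncurryFin ((toFunctional a).smulRight b)

end Pointwise

section Forms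

variable {M : Type*} [TopologicalSpace M] [ChartedSpace E M]

variable (E M) in
/-- (Not necessarily smooth) real differential `k`-forms on the manifold `M` modelled on `E`: at each
point `x`, an alternating `k`-form on the tangent space `TangentSpace 𝓘(ℝ, E) x`, which by definition
is the space `E` (tangent vectors at `x` are read in the preferred chart at `x`). -/
abbrev DForm (k : ℕ) : Type _ :=
  M → E [⋀^Fin k]→L[ℝ] ℝ

/-- The derivative at `y` of the inverse of the preferred chart at `x`, as a map from `E` to the
tangent space at the image of `y`. -/
def chartInvDeriv (x : M) (y : E) : E →L[ℝ] E :=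
  mfderiv 𝓘(ℝ, E) 𝓘(ℝ, E) (extChartAt 𝓘(ℝ, E) x).symm y

/-- The derivative at `x` of the preferred chart at `x`, as a map from the tangent space at `x`
to `E`. -/
def chartDeriv (x : M) : E →L[ℝ] E :=
  mfderiv 𝓘(ℝ, E) 𝓘(ℝ, E) (extChartAt 𝓘(ℝ, E) x) x

/-- The expression of a form in the preferred chart at `x`: the pullback of the form under the
inverse of the chart (meaningful on the target of the chart). -/
def DForm.inChart {k : ℕ} (α : DForm E M k) (x : M) : E → E [⋀^Fin k]→L[ℝ] ℝ := fun y =>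
  (α ((extChartAt 𝓘(ℝ, E) x).symm y)).compContinuousLinearMap (chartInvDeriv x y)

/-- Smooth differential forms. -/
def DForm.Smooth {k : ℕ} (α : DForm E M k) : Prop :=
  ∀ x : M, ContDiffOn ℝ ∞ (α.inChart x) (extChartAt 𝓘(ℝ, E) x).target

/-- The exterior derivative `dα`: at `x`, the pullback under the chart at `x` of the exterior
derivative of the expression of `α` in that chart. -/
def DForm.d {k : ℕ} (α : DForm E M k) : DForm E M (k + 1) := fun x =>
  (extDeriv (α.inChart x) (extChartAt 𝓘(ℝ, E) x x)).compContinuousLinearMap (chartDeriv x)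

/-- The wedge product `θ ∧ α` of a `1`-form and a `k`-form. -/
def DForm.wedge {k : ℕ} (θ : DForm E M 1) (α : DForm E M k) : DForm E M (k + 1) := fun x =>
  wedgeOne (θ x) (α x)

variable (E) in
/-- A function as a `0`-form. -/
def DForm.ofFun (f : M → ℝ) : DForm E M 0 := fun x =>
  ContinuousAlternatingMap.constOfIsEmpty ℝ E (Fin 0) (f x)

/-- The action of `I` on forms, `(Iα)(v₁, …, v_k) = α(I v₁, …, I v_k)`. -/
def DForm.actI {k : ℕ} (α : DForm E M k) : DForm E M k := fun x =>
  (α x).compContinuousLinearMap (complexJ E)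

/-- The action of `I⁻¹` on forms, `(I⁻¹α)(v₁, …, v_k) = α(-I v₁, …, -I v_k)`. -/
def DForm.actIInv {k : ℕ} (α : DForm E M k) : DForm E M k := fun x =>
  (α x).compContinuousLinearMap (-complexJ E)

/-- The twisted differential `d_θ α = dα - θ ∧ α`. -/
def DForm.dTheta {k : ℕ} (θ : DForm E M 1) (α : DForm E M k) : DForm E M (k + 1) :=
  fun x => α.d x - DForm.wedge θ α x

/-- The twisted differential `d^c_θ = I d_θ I⁻¹`. -/
def DForm.dcTheta {k : ℕ} (θ : DForm E M 1) (α : DForm E M k) : DForm E M (k + 1) :=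
  (DForm.dTheta θ α.actIInv).actI

/-- The `2`-form `d_θ d^c_θ f` of a function `f`. -/
def ddcTheta (θ : DForm E M 1) (f : M → ℝ) : DForm E M 2 :=
  DForm.dTheta θ (DForm.dcTheta θ (DForm.ofFun E f))

/-- The bilinear form `g` associated with a `2`-form `Ω` by `Ω(v, w) = g(v, I w)`,
that is `g(v, w) = Ω(I v, w)` when `Ω` is of type `(1,1)`. -/
def assocMetric (Ω : DForm E M 2) (x : M) (v w : E) : ℝ :=
  Ω x ![complexJ E v, w]

/-- `Ω` is of type `(1,1)`, i.e. `I`-invariant. -/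
def IsOneOne (Ω : DForm E M 2) : Prop := Ω.actI = Ω

/-- `Ω` is a (strictly) positive form on the set `V`: `Ω(Iv, v) > 0` for all `v ≠ 0`. -/
def IsPositiveOn (Ω : DForm E M 2) (V : Set M) : Prop :=
  ∀ x ∈ V, ∀ v : E, v ≠ 0 → 0 < assocMetric Ω x v v

/-- `Ω` is an LCK form with Lee form `θ`: `θ` is a closed `1`-form, and `Ω` is the fundamental
form of a Hermitian metric (a smooth positive `(1,1)`-form) with `dΩ = θ ∧ Ω`. -/
structure IsLCKForm (θ : DForm E M 1) (Ω : DForm E M 2) : Prop where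
  smooth_lee : θ.Smooth
  closed_lee : θ.d = 0
  smooth : Ω.Smooth
  oneOne : IsOneOne Ω
  positive : IsPositiveOn Ω univ
  d_eq : Ω.d = DForm.wedge θ Ω

/-- `f` is a smooth strictly `d_θ d^c_θ`-plurisubharmonic function on the open set `V`. -/
def IsStrictPSHOn (θ : DForm E M 1) (f : M → ℝ) (V : Set M) : Prop :=
  ContMDiffOn 𝓘(ℝ, E) 𝓘(ℝ, ℝ) ∞ f V ∧ IsPositiveOn (ddcTheta θ f) V

/-- The derivative `df(v)` of a function along a tangent vector. -/
def lieD (f : M → ℝ) (x : M) (v : E) : ℝ :=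
  mfderiv 𝓘(ℝ, E) 𝓘(ℝ, ℝ) f x v

variable (E) in
/-- `r` is a smooth defining function of `D` near the boundary point `p`: it has nonzero
differential at `p`, and near `p` one has `D = {r ≤ 0}`. -/
def IsDefiningFunctionAt (D : Set M) (p : M) (r : M → ℝ) : Prop :=
  (∃ W : Set M, IsOpen W ∧ p ∈ W ∧ ContMDiffOn 𝓘(ℝ, E) 𝓘(ℝ, ℝ) ∞ r W ∧
    ∀ x ∈ W, x ∈ D ↔ r x ≤ 0) ∧
  ∃ v : E, lieD r p v ≠ 0

variable (E) in
/-- `D` is a (closed) submanifold of `M` of the same dimension, with smooth boundary. Its boundary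
is then the topological frontier of `D`. -/
def IsDomainWithSmoothBoundary (D : Set M) : Prop :=
  IsClosed D ∧ ∀ p ∈ frontier D, ∃ r : M → ℝ, IsDefiningFunctionAt E D p r

/-- The tangent vector `X` at the boundary point `p` of `D` points out of `D` and is normal to the
boundary for the metric associated with `Ω`. -/
def IsOutwardNormal (Ω : DForm E M 2) (D : Set M) (p : M) (X : E) : Prop :=
  ∃ r : M → ℝ, IsDefiningFunctionAt E D p r ∧ 0 < lieD r p X ∧
    ∀ v : E, lieD r p v = 0 → assocMetric Ω p X v = 0

end Forms

end LCK

end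

/-! Since `φ - ψ` vanishes on the boundary of `D` and increases in the outward direction `X`, near
the boundary it is negative inside `D` and positive outside (`eventually_sign_near_boundary`). So
the function equal to `ψ` in `D` and to `φ` outside is locally `max φ ψ` there. It is smoothed to `F
= ψ + h(φ - ψ)` on a compact neighbourhood `N` of the boundary, where `h` is a smooth convex
approximation of `max t 0` (`exists_regularized_max`). The new form is `d_θ d^c_θ F` on `V` and the
old one elsewhere.

Positivity rests on `flatDdc_glue_apply`. With `t = φ - ψ`, the form `d_θ d^c_θ F` is the
combination of those of `φ` and `ψ` with weights `h'(t)` and `1 - h'(t)`, plus `h''(t)` times a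
nonnegative square, plus `(h(t) - t h'(t)) d_θ d^c_θ 1`. The last term has no sign and is special to
the twisted setting: `d_θ` does not kill constants. Rescaling `h` gives `|h - t h'| ≤ δ`, and
compactness of `N` yields a `δ` for which this error is dominated by both positive forms
(`exists_dominates_on_compact`).

The other LCK conditions are local and hold for every `d_θ d^c_θ F`: closedness of `θ` gives both
type `(1,1)` and `d_θ d_θ = 0`. The assembly is in `exists_psh_glue` and `isLCKForm_glue`. -/

noncomputable section

namespace LCK

/-! ### Twisted calculus on a complex vector space. -/

section Flat

variable {E : Type*} [NormedAddCommGroup E] [NormedSpace ℂ E]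

@[simp]
theorem complexJ_complexJ (v : E) : complexJ E (complexJ E v) = -v := by
  simp [complexJ, smul_smul]

theorem two_le_infty : (2 : WithTop ℕ∞) ≤ ∞ := by
  exact WithTop.coe_le_coe.2 (le_top : (2 : ℕ∞) ≤ ⊤)

theorem toFunctional_apply (a : E [⋀^Fin 1]→L[ℝ] ℝ) (v : E) : toFunctional a v = a ![v] := by
  change a _ = a _
  congr 1
  ext i
  fin_cases i
  rfl

theorem form_two_ext {a b : E [⋀^Fin 2]→L[ℝ] ℝ} (h : ∀ v w, a ![v, w] = b ![v, w]) : a = b := by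
  ext v
  have : v = ![v 0, v 1] := by ext i; fin_cases i <;> rfl
  rw [this, h]

theorem form_three_ext {a b : E [⋀^Fin 3]→L[ℝ] ℝ}
    (h : ∀ u v w, a ![u, v, w] = b ![u, v, w]) : a = b := by
  ext v
  have : v = ![v 0, v 1, v 2] := by ext i; fin_cases i <;> rfl
  rw [this, h]

theorem alternatize_zero_apply (f : E →L[ℝ] E [⋀^Fin 0]→L[ℝ] ℝ) (v : E) :
    ContinuousAlternatingMap.alternatizeUncurryFin f ![v] = f v ![] := by
  rw [ContinuousAlternatingMap.alternatizeUncurryFin_apply]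
  simp only [Fin.sum_univ_succ, Finset.univ_eq_empty, Finset.sum_empty, add_zero]
  simp

theorem alternatize_one_apply (f : E →L[ℝ] E [⋀^Fin 1]→L[ℝ] ℝ) (v w : E) :
    ContinuousAlternatingMap.alternatizeUncurryFin f ![v, w] = f v ![w] - f w ![v] := by
  rw [ContinuousAlternatingMap.alternatizeUncurryFin_apply]
  have h0 : Fin.removeNth (0 : Fin 2) ![v, w] = ![w] := by ext i; fin_cases i; rfl
  have h1 : Fin.removeNth (1 : Fin 2) ![v, w] = ![v] := by ext i; fin_cases i; rfl
  rw [Fin.sum_univ_two, h0, h1]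
  simp [sub_eq_add_neg]

theorem alternatize_two_apply (f : E →L[ℝ] E [⋀^Fin 2]→L[ℝ] ℝ) (u v w : E) :
    ContinuousAlternatingMap.alternatizeUncurryFin f ![u, v, w] =
      f u ![v, w] - f v ![u, w] + f w ![u, v] := by
  rw [ContinuousAlternatingMap.alternatizeUncurryFin_apply]
  have h0 : Fin.removeNth (0 : Fin 3) ![u, v, w] = ![v, w] := by ext i; fin_cases i <;> rfl
  have h1 : Fin.removeNth (1 : Fin 3) ![u, v, w] = ![u, w] := by ext i; fin_cases i <;> rfl
  have h2 : Fin.removeNth (2 : Fin 3) ![u, v, w] = ![u, v] := by ext i; fin_cases i <;> rfl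
  rw [Fin.sum_univ_three, h0, h1, h2]
  simp [sub_eq_add_neg]

theorem wedgeOne_zero_apply (a : E [⋀^Fin 1]→L[ℝ] ℝ) (b : E [⋀^Fin 0]→L[ℝ] ℝ) (v : E) :
    wedgeOne a b ![v] = a ![v] * b ![] := by
  rw [wedgeOne, alternatize_zero_apply]
  simp [toFunctional_apply]

theorem wedgeOne_one_apply (a b : E [⋀^Fin 1]→L[ℝ] ℝ) (v w : E) :
    wedgeOne a b ![v, w] = a ![v] * b ![w] - a ![w] * b ![v] := by
  rw [wedgeOne, alternatize_one_apply]
  simp [toFunctional_apply]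

theorem wedgeOne_two_apply (a : E [⋀^Fin 1]→L[ℝ] ℝ) (b : E [⋀^Fin 2]→L[ℝ] ℝ) (u v w : E) :
    wedgeOne a b ![u, v, w] = a ![u] * b ![v, w] - a ![v] * b ![u, w] + a ![w] * b ![u, v] := by
  rw [wedgeOne, alternatize_two_apply]
  simp [toFunctional_apply]

theorem fderiv_form_apply {k : ℕ} {β : E → E [⋀^Fin k]→L[ℝ] ℝ} {y : E}
    (h : DifferentiableAt ℝ β y) (u : E) (v : Fin k → E) :
    fderiv ℝ β y u v = fderiv ℝ (fun z => β z v) y u := by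
  have := (ContinuousAlternatingMap.apply ℝ E ℝ v).hasFDerivAt.comp y h.hasFDerivAt
  have h2 := this.fderiv
  change fderiv ℝ (fun z => β z v) y = _ at h2
  rw [h2]
  rfl

theorem contDiffAt_wedgeOne {k : ℕ} {n : WithTop ℕ∞} {ϑ : E → E [⋀^Fin 1]→L[ℝ] ℝ}
    {β : E → E [⋀^Fin k]→L[ℝ] ℝ}
    {y : E} (hϑ : ContDiffAt ℝ n ϑ y) (hβ : ContDiffAt ℝ n β y) :
    ContDiffAt ℝ n (fun z => wedgeOne (ϑ z) (β z)) y := by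
  have h1 : ContDiffAt ℝ n (fun z => toFunctional (ϑ z)) y :=
    ((ContinuousAlternatingMap.ofSubsingletonLIE (𝕜 := ℝ) (E := E) (F := ℝ)
      (0 : Fin 1)).symm.contDiff).contDiffAt.comp y hϑ
  exact (ContinuousAlternatingMap.alternatizeUncurryFinCLM ℝ E ℝ).contDiff.contDiffAt.comp y
    (h1.smulRight hβ)

theorem contDiffAt_extDeriv {k : ℕ} {m n : WithTop ℕ∞} {β : E → E [⋀^Fin k]→L[ℝ] ℝ} {y : E}
    (hβ : ContDiffAt ℝ n β y) (hmn : m + 1 ≤ n) : ContDiffAt ℝ m (extDeriv β) y :=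
  ContDiffAt.comp (g := ContinuousAlternatingMap.alternatizeUncurryFinCLM ℝ E ℝ) y
    (ContinuousLinearMap.contDiff _).contDiffAt (hβ.fderiv_right hmn)

/-- The twisted differential `dβ - ϑ ∧ β` on a vector space. -/
def flatDTheta {k : ℕ} (ϑ : E → E [⋀^Fin 1]→L[ℝ] ℝ) (β : E → E [⋀^Fin k]→L[ℝ] ℝ) :
    E → E [⋀^Fin (k + 1)]→L[ℝ] ℝ :=
  fun y => extDeriv β y - wedgeOne (ϑ y) (β y)

/-- The `1`-form `d^c_ϑ f` on a complex vector space. -/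
def flatDc (ϑ : E → E [⋀^Fin 1]→L[ℝ] ℝ) (f : E → ℝ) : E → E [⋀^Fin 1]→L[ℝ] ℝ :=
  fun y => (flatDTheta ϑ (fun z => ContinuousAlternatingMap.constOfIsEmpty ℝ E (Fin 0) (f z))
    y).compContinuousLinearMap (complexJ E)

/-- The `2`-form `d_ϑ d^c_ϑ f` on a complex vector space. -/
def flatDdc (ϑ : E → E [⋀^Fin 1]→L[ℝ] ℝ) (f : E → ℝ) : E → E [⋀^Fin 2]→L[ℝ] ℝ :=
  flatDTheta ϑ (flatDc ϑ f)

variable {ϑ : E → E [⋀^Fin 1]→L[ℝ] ℝ} {f g : E → ℝ} {y : E}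

theorem contDiffAt_flatDTheta {k : ℕ} {β : E → E [⋀^Fin k]→L[ℝ] ℝ}
    (hϑ : ContDiffAt ℝ ∞ ϑ y) (hβ : ContDiffAt ℝ ∞ β y) :
    ContDiffAt ℝ ∞ (flatDTheta ϑ β) y :=
  (contDiffAt_extDeriv hβ (by simp)).sub (contDiffAt_wedgeOne hϑ hβ)

theorem contDiffAt_flatDc (hϑ : ContDiffAt ℝ ∞ ϑ y) (hf : ContDiffAt ℝ ∞ f y) :
    ContDiffAt ℝ ∞ (flatDc ϑ f) y := by
  have h0 : ContDiffAt ℝ ∞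
      (fun z => ContinuousAlternatingMap.constOfIsEmpty ℝ E (Fin 0) (f z)) y :=
    ((ContinuousAlternatingMap.constOfIsEmptyLIE ℝ E ℝ (Fin 0)).contDiff).contDiffAt.comp y hf
  exact (ContinuousAlternatingMap.compContinuousLinearMapCLM
    (complexJ E)).contDiff.contDiffAt.comp y (contDiffAt_flatDTheta hϑ h0)

theorem contDiffAt_flatDdc (hϑ : ContDiffAt ℝ ∞ ϑ y) (hf : ContDiffAt ℝ ∞ f y) :
    ContDiffAt ℝ ∞ (flatDdc ϑ f) y :=
  contDiffAt_flatDTheta hϑ (contDiffAt_flatDc hϑ hf)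

theorem _root_.Filter.EventuallyEq.flatDTheta {k : ℕ} {β β' : E → E [⋀^Fin k]→L[ℝ] ℝ}
    (h : β =ᶠ[𝓝 y] β') : flatDTheta ϑ β =ᶠ[𝓝 y] flatDTheta ϑ β' := by
  filter_upwards [h, h.extDeriv] with z h1 h2
  simp [LCK.flatDTheta, h1, h2]

theorem flatDc_apply (v : E) :
    flatDc ϑ f y ![v] = fderiv ℝ f y (complexJ E v) - ϑ y ![complexJ E v] * f y := by
  have h : (complexJ E ∘ ![v] : Fin 1 → E) = ![complexJ E v] := by
    ext i; fin_cases i; rfl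
  rw [flatDc, ContinuousAlternatingMap.compContinuousLinearMap_apply, h, flatDTheta,
    ContinuousAlternatingMap.sub_apply, wedgeOne_zero_apply, extDeriv_constOfIsEmpty]
  simp

theorem differentiableAt_fderiv_apply (hf : ContDiffAt ℝ ∞ f y) (v : E) :
    DifferentiableAt ℝ (fun z => fderiv ℝ f z v) y :=
  ((hf.fderiv_right (m := ∞) (by simp)).differentiableAt (by simp)).clm_apply
    (differentiableAt_const v)

theorem differentiableAt_form_apply {k : ℕ} {β : E → E [⋀^Fin k]→L[ℝ] ℝ}
    (h : DifferentiableAt ℝ β y) (v : Fin k → E) :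
    DifferentiableAt ℝ (fun z => β z v) y :=
  (ContinuousAlternatingMap.apply ℝ E ℝ v).differentiableAt.comp y h

/-- Product rule applied to `flatDc_apply`. This full expansion in derivatives of `f` and `ϑ`
reduces the later identities to symmetry of second derivatives and `ring`. -/
theorem flatDdc_apply (hϑ : ContDiffAt ℝ ∞ ϑ y) (hf : ContDiffAt ℝ ∞ f y) (v w : E) :
    flatDdc ϑ f y ![v, w] =
      (fderiv ℝ (fun z => fderiv ℝ f z (complexJ E w)) y v
        - fderiv ℝ ϑ y v ![complexJ E w] * f y - ϑ y ![complexJ E w] * fderiv ℝ f y v)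
      - (fderiv ℝ (fun z => fderiv ℝ f z (complexJ E v)) y w
        - fderiv ℝ ϑ y w ![complexJ E v] * f y - ϑ y ![complexJ E v] * fderiv ℝ f y w)
      - ϑ y ![v] * (fderiv ℝ f y (complexJ E w) - ϑ y ![complexJ E w] * f y)
      + ϑ y ![w] * (fderiv ℝ f y (complexJ E v) - ϑ y ![complexJ E v] * f y) := by
  have hdϑ : DifferentiableAt ℝ ϑ y := hϑ.differentiableAt (by simp)
  have hdf : DifferentiableAt ℝ f y := hf.differentiableAt (by simp)
  have hγ : DifferentiableAt ℝ (flatDc ϑ f) y :=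
    (contDiffAt_flatDc hϑ hf).differentiableAt (by simp)
  have key : ∀ v w : E, fderiv ℝ (flatDc ϑ f) y v ![w] =
      fderiv ℝ (fun z => fderiv ℝ f z (complexJ E w)) y v
        - fderiv ℝ ϑ y v ![complexJ E w] * f y - ϑ y ![complexJ E w] * fderiv ℝ f y v := by
    intro v w
    rw [fderiv_form_apply hγ]
    simp only [flatDc_apply]
    rw [fderiv_fun_sub (differentiableAt_fderiv_apply hf _)
      ((differentiableAt_form_apply hdϑ _).fun_mul hdf),
      fderiv_fun_mul (differentiableAt_form_apply hdϑ _) hdf, fderiv_form_apply hdϑ]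
    simp
    ring
  rw [flatDdc, flatDTheta, ContinuousAlternatingMap.sub_apply, wedgeOne_one_apply, extDeriv,
    alternatize_one_apply, key, key, flatDc_apply, flatDc_apply]
  ring

theorem fderiv_fderiv_apply_symm (hf : ContDiffAt ℝ ∞ f y) (v w : E) :
    fderiv ℝ (fun z => fderiv ℝ f z w) y v = fderiv ℝ (fun z => fderiv ℝ f z v) y w := by
  have hd : DifferentiableAt ℝ (fderiv ℝ f) y :=
    (hf.fderiv_right (m := ∞) (by simp)).differentiableAt (by simp)
  have hs : IsSymmSndFDerivAt ℝ f y := hf.isSymmSndFDerivAt (by simpa using two_le_infty)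
  have h : ∀ v w, fderiv ℝ (fun z => fderiv ℝ f z w) y v = fderiv ℝ (fderiv ℝ f) y v w := by
    intro v w
    rw [fderiv_clm_apply hd (differentiableAt_const w)]
    simp
  rw [h, h, hs v w]

theorem fderiv_form_one_symm (hd : extDeriv ϑ y = 0) (v w : E) :
    fderiv ℝ ϑ y v ![w] = fderiv ℝ ϑ y w ![v] := by
  have := congrArg (fun a => a ![v, w]) hd
  simp only [extDeriv, alternatize_one_apply] at this
  simpa [sub_eq_zero] using this

theorem form_one_neg (a : E [⋀^Fin 1]→L[ℝ] ℝ) (v : E) : a ![-v] = - a ![v] := by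
  rw [← toFunctional_apply, ← toFunctional_apply, map_neg]

/-- Substituting `Iv, Iw` permutes the terms of the expansion, once the second derivative of `f` and
the first derivative of `ϑ` are known to be symmetric; the latter is closedness of `ϑ`. -/
theorem flatDdc_oneOne (hϑ : ContDiffAt ℝ ∞ ϑ y) (hf : ContDiffAt ℝ ∞ f y)
    (hd : extDeriv ϑ y = 0) :
    (flatDdc ϑ f y).compContinuousLinearMap (complexJ E) = flatDdc ϑ f y := by
  refine form_two_ext fun v w => ?_
  have h : (complexJ E ∘ ![v, w] : Fin 2 → E) = ![complexJ E v, complexJ E w] := by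
    ext i; fin_cases i <;> rfl
  rw [ContinuousAlternatingMap.compContinuousLinearMap_apply, h, flatDdc_apply hϑ hf,
    flatDdc_apply hϑ hf]
  have e1 := fderiv_fderiv_apply_symm hf v (complexJ E w)
  have e2 := fderiv_fderiv_apply_symm hf w (complexJ E v)
  have e3 := fderiv_form_one_symm hd v (complexJ E w)
  have e4 := fderiv_form_one_symm hd w (complexJ E v)
  simp only [complexJ_complexJ, form_one_neg, map_neg, fderiv_fun_neg]
  simp only [neg_apply]
  rw [e1, e2, e3, e4]
  ring

theorem extDeriv_wedgeOne (hϑ : DifferentiableAt ℝ ϑ y) {γ : E → E [⋀^Fin 1]→L[ℝ] ℝ}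
    (hγ : DifferentiableAt ℝ γ y) (hw : DifferentiableAt ℝ (fun z => wedgeOne (ϑ z) (γ z)) y)
    (hd : extDeriv ϑ y = 0) :
    extDeriv (fun z => wedgeOne (ϑ z) (γ z)) y = - wedgeOne (ϑ y) (extDeriv γ y) := by
  have key : ∀ u v w : E, fderiv ℝ (fun z => wedgeOne (ϑ z) (γ z)) y u ![v, w] =
      fderiv ℝ ϑ y u ![v] * γ y ![w] + ϑ y ![v] * fderiv ℝ γ y u ![w]
      - fderiv ℝ ϑ y u ![w] * γ y ![v] - ϑ y ![w] * fderiv ℝ γ y u ![v] := by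
    intro u v w
    rw [fderiv_form_apply hw]
    simp only [wedgeOne_one_apply]
    have a := fun v => differentiableAt_form_apply hϑ ![v]
    have b := fun v => differentiableAt_form_apply hγ ![v]
    rw [fderiv_fun_sub ((a v).fun_mul (b w)) ((a w).fun_mul (b v)), fderiv_fun_mul (a v) (b w),
      fderiv_fun_mul (a w) (b v)]
    simp only [fderiv_form_apply hϑ, fderiv_form_apply hγ]
    simp
    ring
  refine form_three_ext fun u v w => ?_
  rw [ContinuousAlternatingMap.neg_apply, wedgeOne_two_apply]
  simp only [extDeriv, alternatize_two_apply, alternatize_one_apply, key]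
  rw [fderiv_form_one_symm hd v u, fderiv_form_one_symm hd w u, fderiv_form_one_symm hd w v]
  ring

/-- This is `d_ϑ d_ϑ = 0`: as `d d = 0` and `dϑ = 0`, the left side is `ϑ ∧ dγ`, and subtracting `ϑ
∧ γ` from `dγ` changes nothing because `ϑ ∧ ϑ = 0`. It yields the LCK equation for `d_θ d^c_θ F`. -/
theorem extDeriv_flatDTheta (hϑ : ContDiffAt ℝ ∞ ϑ y) {γ : E → E [⋀^Fin 1]→L[ℝ] ℝ}
    (hγ : ContDiffAt ℝ ∞ γ y) (hd : extDeriv ϑ y = 0) :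
    extDeriv (flatDTheta ϑ γ) y = wedgeOne (ϑ y) (flatDTheta ϑ γ y) := by
  have h1 : ContDiffAt ℝ ∞ (extDeriv γ) y := contDiffAt_extDeriv hγ (by simp)
  have h2 : ContDiffAt ℝ ∞ (fun z => wedgeOne (ϑ z) (γ z)) y := contDiffAt_wedgeOne hϑ hγ
  have e : extDeriv (flatDTheta ϑ γ) y = extDeriv (extDeriv γ) y
      - extDeriv (fun z => wedgeOne (ϑ z) (γ z)) y := by
    unfold flatDTheta
    rw [extDeriv, fderiv_fun_sub (h1.differentiableAt (by simp)) (h2.differentiableAt (by simp))]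
    simp only [extDeriv, ← ContinuousAlternatingMap.alternatizeUncurryFinCLM_apply, map_sub]
  rw [e, extDeriv_extDeriv_apply hγ (by simpa using two_le_infty),
    extDeriv_wedgeOne (hϑ.differentiableAt (by simp)) (hγ.differentiableAt (by simp))
      (h2.differentiableAt (by simp)) hd, flatDTheta]
  refine form_three_ext fun u v w => ?_
  simp only [ContinuousAlternatingMap.neg_apply, ContinuousAlternatingMap.sub_apply,
    wedgeOne_two_apply, wedgeOne_one_apply]
  change 0 - _ = _
  ring

end Flat

/-! ### The twisted Hessian of a regularized maximum. -/

section FlatMax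

variable {E : Type*} [NormedAddCommGroup E] [NormedSpace ℂ E]
  {ϑ : E → E [⋀^Fin 1]→L[ℝ] ℝ} {f g : E → ℝ} {y : E}

/-- Chain rule to second order. Second derivatives of `h` produce the square term. The zeroth-order
part of the operator sees the value `h(t)`, whereas a combination with weights `h'` and `1 - h'`
would give `t h'(t)`; the discrepancy multiplies the operator applied to the constant `1`. -/
theorem flatDdc_glue_apply (hϑ : ContDiffAt ℝ ∞ ϑ y) (hf : ContDiffAt ℝ ∞ f y)
    (hg : ContDiffAt ℝ ∞ g y) {h : ℝ → ℝ} (hh : ContDiff ℝ ∞ h) (v : E) :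
    flatDdc ϑ (fun z => g z + h (f z - g z)) y ![complexJ E v, v] =
      deriv h (f y - g y) * flatDdc ϑ f y ![complexJ E v, v]
      + (1 - deriv h (f y - g y)) * flatDdc ϑ g y ![complexJ E v, v]
      + deriv (deriv h) (f y - g y) * ((fderiv ℝ f y (complexJ E v) - fderiv ℝ g y (complexJ E v)) ^ 2
        + (fderiv ℝ f y v - fderiv ℝ g y v) ^ 2)
      + (h (f y - g y) - (f y - g y) * deriv h (f y - g y))
        * flatDdc ϑ (fun _ => 1) y ![complexJ E v, v] := by
  have hh1 : Differentiable ℝ h := hh.differentiable (by simp)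
  have hh' : ContDiff ℝ ∞ (deriv h) := (contDiff_infty_iff_deriv.1 hh).2
  have hF : ContDiffAt ℝ ∞ (fun z => g z + h (f z - g z)) y :=
    hg.add (hh.contDiffAt.comp y (hf.sub hg))
  have hD : ∀ z, DifferentiableAt ℝ f z → DifferentiableAt ℝ g z → ∀ w,
      fderiv ℝ (fun z => g z + h (f z - g z)) z w = fderiv ℝ g z w
        + deriv h (f z - g z) * (fderiv ℝ f z w - fderiv ℝ g z w) := by
    intro z hfz hgz w
    have := (hgz.hasFDerivAt.add
      ((hh1 (f z - g z)).hasDerivAt.comp_hasFDerivAt z (hfz.hasFDerivAt.sub hgz.hasFDerivAt)))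
    have h2 : fderiv ℝ (fun z => g z + h (f z - g z)) z = _ := this.fderiv
    rw [h2]
    simp
  have hev : ∀ᶠ z in 𝓝 y, DifferentiableAt ℝ f z ∧ DifferentiableAt ℝ g z := by
    have a := (hf.of_le (m := 1) (by simp)).eventually (by simp)
    have b := (hg.of_le (m := 1) (by simp)).eventually (by simp)
    filter_upwards [a, b] with z h1 h2
    exact ⟨h1.differentiableAt (by simp), h2.differentiableAt (by simp)⟩
  have hfy : DifferentiableAt ℝ f y := hf.differentiableAt (by simp)
  have hgy : DifferentiableAt ℝ g y := hg.differentiableAt (by simp)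
  have hD2 : ∀ u w, fderiv ℝ (fun x => fderiv ℝ (fun z => g z + h (f z - g z)) x w) y u =
      fderiv ℝ (fun x => fderiv ℝ g x w) y u
      + deriv (deriv h) (f y - g y) * (fderiv ℝ f y u - fderiv ℝ g y u)
        * (fderiv ℝ f y w - fderiv ℝ g y w)
      + deriv h (f y - g y) * (fderiv ℝ (fun x => fderiv ℝ f x w) y u
        - fderiv ℝ (fun x => fderiv ℝ g x w) y u) := by
    intro u w
    have e : (fun x => fderiv ℝ (fun z => g z + h (f z - g z)) x w) =ᶠ[𝓝 y]
        fun x => fderiv ℝ g x w + deriv h (f x - g x) * (fderiv ℝ f x w - fderiv ℝ g x w) := by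
      filter_upwards [hev] with x hx
      exact hD x hx.1 hx.2 w
    rw [e.fderiv_eq]
    have hfw := (differentiableAt_fderiv_apply hf w).hasFDerivAt
    have hgw := (differentiableAt_fderiv_apply hg w).hasFDerivAt
    have hc := ((hh'.differentiable (by simp)) (f y - g y)).hasDerivAt.comp_hasFDerivAt y
      (hfy.hasFDerivAt.sub hgy.hasFDerivAt)
    have := hgw.add (hc.mul (hfw.sub hgw))
    have h2 : fderiv ℝ (fun x => fderiv ℝ g x w
      + deriv h (f x - g x) * (fderiv ℝ f x w - fderiv ℝ g x w)) y = _ := this.fderiv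
    rw [h2]
    simp
    ring
  rw [flatDdc_apply hϑ hF, flatDdc_apply hϑ hf, flatDdc_apply hϑ hg,
    flatDdc_apply hϑ contDiffAt_const]
  simp only [hD2, hD y hfy hgy]
  simp only [complexJ_complexJ, form_one_neg, map_neg, fderiv_fun_neg, neg_apply]
  simp
  ring

end FlatMax

/-! ### Transfer between forms on the manifold and their chart expressions. -/

section Charts

variable {E : Type*} [NormedAddCommGroup E] [NormedSpace ℂ E]
  {M : Type*} [TopologicalSpace M] [ChartedSpace E M]

instance isManifold_real [IsManifold 𝓘(ℂ, E) ω M] : IsManifold 𝓘(ℝ, E) ∞ M := by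
  refine isManifold_of_contDiffOn _ _ _ fun e e' he he' => ?_
  have h := (contDiffGroupoid ω 𝓘(ℂ, E)).compatible he he'
  rw [contDiffGroupoid, mem_groupoid_of_pregroupoid] at h
  have h1 : ContDiffOn ℂ ω _ _ := h.1
  exact (h1.restrict_scalars ℝ).of_le le_top

theorem isOpen_chart_target (x : M) : IsOpen (extChartAt 𝓘(ℝ, E) x).target :=
  isOpen_extChartAt_target x

theorem chart_target_mem_nhds {x : M} {y : E} (hy : y ∈ (extChartAt 𝓘(ℝ, E) x).target) :
    (extChartAt 𝓘(ℝ, E) x).target ∈ 𝓝 y :=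
  (isOpen_chart_target x).mem_nhds hy

theorem mem_chart_source_of_target {x : M} {y : E} (hy : y ∈ (extChartAt 𝓘(ℝ, E) x).target) :
    (extChartAt 𝓘(ℝ, E) x).symm y ∈ (extChartAt 𝓘(ℝ, E) x).source :=
  (extChartAt 𝓘(ℝ, E) x).map_target hy

variable (E) in
/-- The change of coordinates from the preferred chart at `p` to the preferred chart at `x`. -/
def transition (p x : M) : E → E :=
  extChartAt 𝓘(ℝ, E) x ∘ (extChartAt 𝓘(ℝ, E) p).symm

theorem contDiffAt_transition [IsManifold 𝓘(ℝ, E) ∞ M] {p x : M} {z : E}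
    (hz : z ∈ (extChartAt 𝓘(ℝ, E) p).target)
    (hx : (extChartAt 𝓘(ℝ, E) p).symm z ∈ (extChartAt 𝓘(ℝ, E) x).source) :
    ContDiffAt ℝ ∞ (transition E p x) z := by
  have := contDiffWithinAt_ext_coord_change (n := ∞) (I := 𝓘(ℝ, E)) x p (y := z)
    (by simp [PartialEquiv.trans_source]; exact ⟨by simpa using hz, by simpa using hx⟩)
  simpa [contDiffWithinAt_univ] using! this

theorem differentiableAt_transition_complex [IsManifold 𝓘(ℂ, E) ω M] {p x : M} {z : E}
    (hz : z ∈ (extChartAt 𝓘(ℝ, E) p).target)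
    (hx : (extChartAt 𝓘(ℝ, E) p).symm z ∈ (extChartAt 𝓘(ℝ, E) x).source) :
    DifferentiableAt ℂ (transition E p x) z := by
  have := contDiffWithinAt_ext_coord_change (n := ω) (I := 𝓘(ℂ, E)) x p (y := z)
    (by simp [PartialEquiv.trans_source]; exact ⟨by simpa using hz, by simpa using hx⟩)
  have h2 : ContDiffAt ℂ ω (transition E p x) z := by
    simpa [contDiffWithinAt_univ] using! this
  exact h2.differentiableAt (by simp)

theorem mdifferentiableAt_chart_symm [IsManifold 𝓘(ℝ, E) ∞ M] {x : M} {y : E}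
    (hy : y ∈ (extChartAt 𝓘(ℝ, E) x).target) :
    MDifferentiableAt 𝓘(ℝ, E) 𝓘(ℝ, E) (extChartAt 𝓘(ℝ, E) x).symm y := by
  have := mdifferentiableWithinAt_extChartAt_symm (I := 𝓘(ℝ, E)) hy
  simpa [mdifferentiableWithinAt_univ] using this

/-- A tangent vector at a point is read in that point's own preferred chart, so the target chart of
the transition varies with `y`. -/
theorem chartInvDeriv_eq_fderiv [IsManifold 𝓘(ℝ, E) ∞ M] {x : M} {y : E}
    (hy : y ∈ (extChartAt 𝓘(ℝ, E) x).target) :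
    chartInvDeriv x y = fderiv ℝ (transition E x ((extChartAt 𝓘(ℝ, E) x).symm y)) y := by
  refine Eq.trans (mdifferentiableAt_chart_symm hy).mfderiv ?_
  simp only [modelWithCornersSelf_coe, range_id, fderivWithin_univ]
  rfl

/-- The real derivative of a holomorphic transition map is complex linear. This makes `I` well
defined as multiplication by `i` in every chart. -/
theorem chartInvDeriv_complexJ [IsManifold 𝓘(ℂ, E) ω M] {x : M} {y : E}
    (hy : y ∈ (extChartAt 𝓘(ℝ, E) x).target) (v : E) :
    chartInvDeriv x y (complexJ E v) = complexJ E (chartInvDeriv x y v) := by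
  rw [chartInvDeriv_eq_fderiv hy]
  have h := differentiableAt_transition_complex hy
    (mem_extChartAt_source (I := 𝓘(ℝ, E)) ((extChartAt 𝓘(ℝ, E) x).symm y))
  rw [h.fderiv_restrictScalars ℝ]
  simp [complexJ]

theorem chartDeriv_eq_id [IsManifold 𝓘(ℝ, E) ∞ M] (x : M) :
    chartDeriv (E := E) x = ContinuousLinearMap.id ℝ E :=
  mfderiv_extChartAt_self (I := 𝓘(ℝ, E))

theorem chartInvDeriv_self [IsManifold 𝓘(ℝ, E) ∞ M] (x : M) :
    chartInvDeriv x (extChartAt 𝓘(ℝ, E) x x) = ContinuousLinearMap.id ℝ E := by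
  have := mfderivWithin_range_extChartAt_symm (I := 𝓘(ℝ, E)) (x := x)
  simpa [mfderivWithin_univ] using! this

theorem chartInvDeriv_left_inv [IsManifold 𝓘(ℝ, E) ∞ M] {x : M} {y : E}
    (hy : y ∈ (extChartAt 𝓘(ℝ, E) x).target) :
    ∃ L : E →L[ℝ] E, L ∘L chartInvDeriv x y = ContinuousLinearMap.id ℝ E ∧
      chartInvDeriv x y ∘L L = ContinuousLinearMap.id ℝ E := by
  have h1 := mfderiv_extChartAt_comp_mfderivWithin_extChartAt_symm (I := 𝓘(ℝ, E)) hy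
  have h2 := mfderivWithin_extChartAt_symm_comp_mfderiv_extChartAt (I := 𝓘(ℝ, E)) hy
  simp only [modelWithCornersSelf_coe, range_id, mfderivWithin_univ] at h1 h2
  exact ⟨_, h1, h2⟩

theorem chartInvDeriv_transition [IsManifold 𝓘(ℝ, E) ∞ M] {p x : M} {z : E}
    (hz : z ∈ (extChartAt 𝓘(ℝ, E) p).target)
    (hx : (extChartAt 𝓘(ℝ, E) p).symm z ∈ (extChartAt 𝓘(ℝ, E) x).source) :
    chartInvDeriv p z = chartInvDeriv x (transition E p x z) ∘L fderiv ℝ (transition E p x) z := by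
  have e : (extChartAt 𝓘(ℝ, E) p).symm =ᶠ[𝓝 z]
      (extChartAt 𝓘(ℝ, E) x).symm ∘ transition E p x := by
    have hc : ContinuousAt (extChartAt 𝓘(ℝ, E) p).symm z := continuousAt_extChartAt_symm'' hz
    filter_upwards [hc.preimage_mem_nhds (extChartAt_source_mem_nhds' hx)] with w hw
    exact ((extChartAt 𝓘(ℝ, E) x).left_inv hw).symm
  have ht : transition E p x z ∈ (extChartAt 𝓘(ℝ, E) x).target :=
    (extChartAt 𝓘(ℝ, E) x).map_source hx
  have hd : DifferentiableAt ℝ (transition E p x) z :=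
    (contDiffAt_transition hz hx).differentiableAt (by simp)
  have h := mfderiv_comp z (mdifferentiableAt_chart_symm ht) hd.mdifferentiableAt
  rw [mfderiv_eq_fderiv] at h
  exact e.mfderiv_eq.trans h

theorem DForm.inChart_transition [IsManifold 𝓘(ℝ, E) ∞ M] {k : ℕ} (α : DForm E M k) {p x : M}
    {z : E} (hz : z ∈ (extChartAt 𝓘(ℝ, E) p).target)
    (hx : (extChartAt 𝓘(ℝ, E) p).symm z ∈ (extChartAt 𝓘(ℝ, E) x).source) :
    α.inChart p z = (α.inChart x (transition E p x z)).compContinuousLinearMap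
      (fderiv ℝ (transition E p x) z) := by
  have e : (extChartAt 𝓘(ℝ, E) x).symm (transition E p x z) = (extChartAt 𝓘(ℝ, E) p).symm z :=
    (extChartAt 𝓘(ℝ, E) x).left_inv hx
  rw [DForm.inChart, DForm.inChart, chartInvDeriv_transition hz hx, e]
  rfl

theorem DForm.inChart_self [IsManifold 𝓘(ℝ, E) ∞ M] {k : ℕ} (α : DForm E M k) (x : M) :
    α.inChart x (extChartAt 𝓘(ℝ, E) x x) = α x := by
  rw [DForm.inChart, chartInvDeriv_self, extChartAt_to_inv]
  rfl

theorem DForm.d_apply [IsManifold 𝓘(ℝ, E) ∞ M] {k : ℕ} (α : DForm E M k) (x : M) :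
    α.d x = extDeriv (α.inChart x) (extChartAt 𝓘(ℝ, E) x x) := by
  rw [DForm.d, chartDeriv_eq_id]
  rfl

/-- The expression of `dα` in a chart is the exterior derivative of the expression of `α`. -/
theorem DForm.inChart_d [IsManifold 𝓘(ℝ, E) ∞ M] {k : ℕ} (α : DForm E M k) {x : M} {y : E}
    (hy : y ∈ (extChartAt 𝓘(ℝ, E) x).target) (hα : DifferentiableAt ℝ (α.inChart x) y) :
    α.d.inChart x y = extDeriv (α.inChart x) y := by
  set p := (extChartAt 𝓘(ℝ, E) x).symm y with hp
  have hpx : p ∈ (extChartAt 𝓘(ℝ, E) x).source := mem_chart_source_of_target hy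
  set z := extChartAt 𝓘(ℝ, E) p p with hzdef
  have hz : z ∈ (extChartAt 𝓘(ℝ, E) p).target := mem_extChartAt_target p
  have hzp : (extChartAt 𝓘(ℝ, E) p).symm z = p := extChartAt_to_inv p
  have hzx : (extChartAt 𝓘(ℝ, E) p).symm z ∈ (extChartAt 𝓘(ℝ, E) x).source := by rwa [hzp]
  have hT : transition E p x z = y := by
    rw [transition, Function.comp_apply, hzp, hp, (extChartAt 𝓘(ℝ, E) x).right_inv hy]
  have hev : α.inChart p =ᶠ[𝓝 z] fun w =>
      (α.inChart x (transition E p x w)).compContinuousLinearMap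
        (fderiv ℝ (transition E p x) w) := by
    have hc : ContinuousAt (extChartAt 𝓘(ℝ, E) p).symm z := continuousAt_extChartAt_symm'' hz
    filter_upwards [hc.preimage_mem_nhds (extChartAt_source_mem_nhds' hzx),
      chart_target_mem_nhds hz] with w hw hw'
    exact α.inChart_transition hw' hw
  -- At `p` the exterior derivative is computed in the chart at `p`; naturality of `extDeriv` under
  -- the transition map carries it to the chart at `x`.
  have hd : α.d p = (extDeriv (α.inChart x) y).compContinuousLinearMap
      (fderiv ℝ (transition E p x) z) := by
    rw [DForm.d_apply, hev.extDeriv_eq, extDeriv_pullback (r := ∞) (by rwa [hT])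
      (contDiffAt_transition hz hzx) (by simpa using two_le_infty), hT]
  have hinv : fderiv ℝ (transition E p x) z ∘L chartInvDeriv x y = ContinuousLinearMap.id ℝ E := by
    have h1 := chartInvDeriv_transition hz hzx
    rw [hT, hzdef, chartInvDeriv_self, ← hzdef] at h1
    obtain ⟨L, hL1, hL2⟩ := chartInvDeriv_left_inv hy
    have : L = fderiv ℝ (transition E p x) z := by
      calc L = L ∘L (chartInvDeriv x y ∘L fderiv ℝ (transition E p x) z) := by rw [← h1]; rfl
        _ = (L ∘L chartInvDeriv x y) ∘L fderiv ℝ (transition E p x) z := rfl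
        _ = _ := by rw [hL1]; rfl
    rw [← this, hL1]
  rw [DForm.inChart, ← hp, hd]
  ext v
  simp only [ContinuousAlternatingMap.compContinuousLinearMap_apply]
  congr 1
  ext i
  exact congrArg (fun L : E →L[ℝ] E => L (v i)) hinv

theorem compContinuousLinearMap_wedgeOne {k : ℕ} (a : E [⋀^Fin 1]→L[ℝ] ℝ) (b : E [⋀^Fin k]→L[ℝ] ℝ)
    (L : E →L[ℝ] E) :
    (wedgeOne a b).compContinuousLinearMap L =
      wedgeOne (a.compContinuousLinearMap L) (b.compContinuousLinearMap L) := by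
  ext v
  simp only [wedgeOne, ContinuousAlternatingMap.compContinuousLinearMap_apply,
    ContinuousAlternatingMap.alternatizeUncurryFin_apply, ContinuousLinearMap.smulRight_apply,
    toFunctional_apply, ContinuousAlternatingMap.smul_apply]
  refine Finset.sum_congr rfl fun i _ => ?_
  congr 3
  ext j
  fin_cases j
  rfl

theorem DForm.inChart_wedge {k : ℕ} (θ : DForm E M 1) (α : DForm E M k) (x : M) (y : E) :
    (DForm.wedge θ α).inChart x y = wedgeOne (θ.inChart x y) (α.inChart x y) :=
  compContinuousLinearMap_wedgeOne _ _ _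

theorem DForm.inChart_actI [IsManifold 𝓘(ℂ, E) ω M] {k : ℕ} (α : DForm E M k) {x : M} {y : E}
    (hy : y ∈ (extChartAt 𝓘(ℝ, E) x).target) :
    α.actI.inChart x y = (α.inChart x y).compContinuousLinearMap (complexJ E) := by
  ext v
  simp only [DForm.inChart, DForm.actI, ContinuousAlternatingMap.compContinuousLinearMap_apply]
  congr 1
  ext i
  exact (chartInvDeriv_complexJ hy (v i)).symm

theorem DForm.actIInv_ofFun {N : Type*} (f : N → ℝ) : (DForm.ofFun E f).actIInv = DForm.ofFun E f := rfl

theorem DForm.inChart_congr {k : ℕ} {α β : DForm E M k} {x : M} {y : E}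
    (hy : y ∈ (extChartAt 𝓘(ℝ, E) x).target)
    (h : α =ᶠ[𝓝 ((extChartAt 𝓘(ℝ, E) x).symm y)] β) : α.inChart x =ᶠ[𝓝 y] β.inChart x := by
  have hc : ContinuousAt (extChartAt 𝓘(ℝ, E) x).symm y := continuousAt_extChartAt_symm'' hy
  filter_upwards [hc.eventually h] with w hw
  rw [DForm.inChart, DForm.inChart, hw]

theorem DForm.d_congr [IsManifold 𝓘(ℝ, E) ∞ M] {k : ℕ} {α β : DForm E M k} {x : M}
    (h : α =ᶠ[𝓝 x] β) : α.d x = β.d x := by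
  rw [DForm.d_apply, DForm.d_apply]
  refine (DForm.inChart_congr (mem_extChartAt_target x) ?_).extDeriv_eq
  rwa [extChartAt_to_inv]

theorem DForm.inChart_dTheta [IsManifold 𝓘(ℝ, E) ∞ M] {k : ℕ} (θ : DForm E M 1) (α : DForm E M k)
    {x : M} {y : E} (hy : y ∈ (extChartAt 𝓘(ℝ, E) x).target)
    (hα : DifferentiableAt ℝ (α.inChart x) y) :
    (DForm.dTheta θ α).inChart x y = flatDTheta (θ.inChart x) (α.inChart x) y := by
  rw [flatDTheta, ← α.inChart_d hy hα, ← DForm.inChart_wedge]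
  rfl

end Charts

/-! ### The form `d_θ d^c_θ f` on the manifold: smoothness, locality, type and LCK equation. -/

section DDC

variable {E : Type*} [NormedAddCommGroup E] [NormedSpace ℂ E]
  {M : Type*} [TopologicalSpace M] [ChartedSpace E M]
  {θ : DForm E M 1} {f : M → ℝ} {x : M} {y : E}

theorem DForm.Smooth.contDiffAt {k : ℕ} {α : DForm E M k} (h : α.Smooth)
    (hy : y ∈ (extChartAt 𝓘(ℝ, E) x).target) : ContDiffAt ℝ ∞ (α.inChart x) y :=
  (h x).contDiffAt (chart_target_mem_nhds hy)

theorem contDiffAt_comp_chart_symm [IsManifold 𝓘(ℝ, E) ∞ M]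
    (hy : y ∈ (extChartAt 𝓘(ℝ, E) x).target)
    (hf : ContMDiffAt 𝓘(ℝ, E) 𝓘(ℝ, ℝ) ∞ f ((extChartAt 𝓘(ℝ, E) x).symm y)) :
    ContDiffAt ℝ ∞ (f ∘ (extChartAt 𝓘(ℝ, E) x).symm) y := by
  have h := (contMDiffOn_extChartAt_symm (I := 𝓘(ℝ, E)) (n := ∞) x).contMDiffAt
    (chart_target_mem_nhds hy)
  exact (hf.comp y h).contDiffAt

/-- The expression of `d_θ d^c_θ f` in a chart. -/
theorem inChart_ddcTheta [IsManifold 𝓘(ℂ, E) ω M] (hθ : θ.Smooth)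
    (hy : y ∈ (extChartAt 𝓘(ℝ, E) x).target)
    (hf : ∀ᶠ q in 𝓝 ((extChartAt 𝓘(ℝ, E) x).symm y), ContMDiffAt 𝓘(ℝ, E) 𝓘(ℝ, ℝ) ∞ f q) :
    (ddcTheta θ f).inChart x =ᶠ[𝓝 y]
      flatDdc (θ.inChart x) (f ∘ (extChartAt 𝓘(ℝ, E) x).symm) := by
  have hc : ContinuousAt (extChartAt 𝓘(ℝ, E) x).symm y := continuousAt_extChartAt_symm'' hy
  have hev := (hc.eventually hf).and (chart_target_mem_nhds hy)
  have h1 : ∀ᶠ w in 𝓝 y, (DForm.dcTheta θ (DForm.ofFun E f)).inChart x w =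
      flatDc (θ.inChart x) (f ∘ (extChartAt 𝓘(ℝ, E) x).symm) w := by
    filter_upwards [hev] with w hw
    have hfw := contDiffAt_comp_chart_symm hw.2 hw.1
    have h0 : DifferentiableAt ℝ ((DForm.ofFun E f).inChart x) w :=
      ((ContinuousAlternatingMap.constOfIsEmptyLIE ℝ E ℝ (Fin 0)).contDiff.contDiffAt.comp w
        hfw).differentiableAt (n := ∞) (by simp)
    rw [DForm.dcTheta, DForm.inChart_actI _ hw.2, DForm.actIInv_ofFun,
      DForm.inChart_dTheta θ _ hw.2 h0]
    rfl
  filter_upwards [h1.eventually_nhds, hev] with w hw hw'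
  have hfw := contDiffAt_comp_chart_symm hw'.2 hw'.1
  have h2 := (contDiffAt_flatDc (hθ.contDiffAt hw'.2) hfw).differentiableAt (by simp)
  rw [ddcTheta, DForm.inChart_dTheta θ _ hw'.2 (h2.congr_of_eventuallyEq hw), flatDdc]
  exact (EventuallyEq.flatDTheta hw).self_of_nhds

variable [IsManifold 𝓘(ℂ, E) ω M]

theorem ddcTheta_apply (hθ : θ.Smooth)
    (hf : ∀ᶠ q in 𝓝 x, ContMDiffAt 𝓘(ℝ, E) 𝓘(ℝ, ℝ) ∞ f q) :
    ddcTheta θ f x = flatDdc (θ.inChart x) (f ∘ (extChartAt 𝓘(ℝ, E) x).symm)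
      (extChartAt 𝓘(ℝ, E) x x) := by
  rw [← (ddcTheta θ f).inChart_self x]
  refine (inChart_ddcTheta hθ (mem_extChartAt_target x) ?_).self_of_nhds
  rwa [extChartAt_to_inv]

theorem contDiffAt_inChart_ddcTheta (hθ : θ.Smooth)
    (hy : y ∈ (extChartAt 𝓘(ℝ, E) x).target)
    (hf : ∀ᶠ q in 𝓝 ((extChartAt 𝓘(ℝ, E) x).symm y), ContMDiffAt 𝓘(ℝ, E) 𝓘(ℝ, ℝ) ∞ f q) :
    ContDiffAt ℝ ∞ ((ddcTheta θ f).inChart x) y :=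
  (contDiffAt_flatDdc (hθ.contDiffAt hy)
    (contDiffAt_comp_chart_symm hy hf.self_of_nhds)).congr_of_eventuallyEq
      (inChart_ddcTheta hθ hy hf)

theorem ddcTheta_congr {g : M → ℝ} (h : g =ᶠ[𝓝 x] f) :
    ddcTheta θ g x = ddcTheta θ f x := by
  have h0 : DForm.ofFun E g =ᶠ[𝓝 x] DForm.ofFun E f := by
    filter_upwards [h] with q hq
    simp [DForm.ofFun, hq]
  have h1 : DForm.dcTheta θ (DForm.ofFun E g) =ᶠ[𝓝 x] DForm.dcTheta θ (DForm.ofFun E f) := by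
    filter_upwards [h0.eventually_nhds] with q hq
    simp only [DForm.dcTheta, DForm.actI, DForm.dTheta, DForm.actIInv_ofFun, DForm.wedge]
    rw [DForm.d_congr hq, hq.self_of_nhds]
  simp only [ddcTheta, DForm.dTheta, DForm.wedge]
  rw [DForm.d_congr h1, h1.self_of_nhds]

theorem extDeriv_inChart_eq_zero (hθ : θ.Smooth) (hd : θ.d = 0)
    (hy : y ∈ (extChartAt 𝓘(ℝ, E) x).target) : extDeriv (θ.inChart x) y = 0 := by
  rw [← θ.inChart_d hy ((hθ.contDiffAt hy).differentiableAt (by simp)), hd]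
  rfl

theorem actI_ddcTheta (hθ : θ.Smooth) (hd : θ.d = 0)
    (hf : ∀ᶠ q in 𝓝 x, ContMDiffAt 𝓘(ℝ, E) 𝓘(ℝ, ℝ) ∞ f q) :
    (ddcTheta θ f).actI x = ddcTheta θ f x := by
  have hx := mem_extChartAt_target (I := 𝓘(ℝ, E)) x
  rw [DForm.actI, ddcTheta_apply hθ hf]
  refine flatDdc_oneOne (hθ.contDiffAt hx) (contDiffAt_comp_chart_symm hx ?_)
    (extDeriv_inChart_eq_zero hθ hd hx)
  rw [extChartAt_to_inv]
  exact hf.self_of_nhds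

theorem d_ddcTheta (hθ : θ.Smooth) (hd : θ.d = 0)
    (hf : ∀ᶠ q in 𝓝 x, ContMDiffAt 𝓘(ℝ, E) 𝓘(ℝ, ℝ) ∞ f q) :
    (ddcTheta θ f).d x = DForm.wedge θ (ddcTheta θ f) x := by
  have hx := mem_extChartAt_target (I := 𝓘(ℝ, E)) x
  have hfx : ContDiffAt ℝ ∞ (f ∘ (extChartAt 𝓘(ℝ, E) x).symm) (extChartAt 𝓘(ℝ, E) x x) := by
    refine contDiffAt_comp_chart_symm hx ?_
    rw [extChartAt_to_inv]
    exact hf.self_of_nhds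
  have he := inChart_ddcTheta hθ hx (by rwa [extChartAt_to_inv])
  rw [DForm.d_apply, he.extDeriv_eq, DForm.wedge, ddcTheta_apply hθ hf, ← θ.inChart_self x]
  exact extDeriv_flatDTheta (hθ.contDiffAt hx) (contDiffAt_flatDc (hθ.contDiffAt hx) hfx)
    (extDeriv_inChart_eq_zero hθ hd hx)

end DDC

/-! ### Smooth convex approximations of `max t 0`. -/

section RegularizedMax

theorem smoothTransition_one_sub (x : ℝ) :
    Real.smoothTransition (1 - x) = 1 - Real.smoothTransition x := by
  have h := Real.smoothTransition.pos_denom x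
  simp only [Real.smoothTransition, sub_sub_cancel]
  rw [eq_sub_iff_add_eq, add_comm (expNegInvGlue (1 - x)), ← add_div, add_comm, div_self h.ne']

/-- A smooth convex function equal to `max t 0` outside of `[-1, 1]`. -/
theorem exists_unit_regularized_max : ∃ h : ℝ → ℝ, ContDiff ℝ ∞ h ∧ (∀ t ≤ -1, h t = 0) ∧
    (∀ t, 1 ≤ t → h t = t) ∧ (∀ t, 0 ≤ deriv h t ∧ deriv h t ≤ 1) ∧
    ∀ t, 0 ≤ deriv (deriv h) t := by
  -- The function sought is the primitive of this smooth monotone step, which runs from `0` at `-1`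
  -- to `1` at `1`.
  set k : ℝ → ℝ := fun s => Real.smoothTransition ((s + 1) / 2) with hk
  have hkc : ContDiff ℝ ∞ k := by
    have : ContDiff ℝ ∞ Real.smoothTransition := Real.smoothTransition.contDiff
    exact this.comp (by fun_prop)
  have hcont : Continuous k := hkc.continuous
  have hint : ∀ a b, IntervalIntegrable k MeasureTheory.volume a b :=
    fun a b => hcont.intervalIntegrable a b
  have hderiv : ∀ t, HasDerivAt (fun t => ∫ s in (-1 : ℝ)..t, k s) (k t) t := fun t =>
    (hcont.integral_hasStrictDerivAt (-1) t).hasDerivAt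
  have hd : deriv (fun t => ∫ s in (-1 : ℝ)..t, k s) = k := funext fun t => (hderiv t).deriv
  -- This symmetry makes the integral of `k` over `[-1, 1]` equal to `1`, so that the primitive is
  -- exactly `t`, with no additive constant, for `t ≥ 1`.
  have hneg : ∀ s, k (-s) = 1 - k s := by
    intro s
    have := smoothTransition_one_sub ((s + 1) / 2)
    simp only [hk]
    rw [← this]
    congr 1
    ring
  have hone : ∫ s in (-1 : ℝ)..1, k s = 1 := by
    have e1 : ∫ s in (-1 : ℝ)..1, k (-s) = ∫ s in (-1 : ℝ)..1, k s := by
      rw [intervalIntegral.integral_comp_neg]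
      simp
    have e2 : ∫ s in (-1 : ℝ)..1, k (-s) = 2 - ∫ s in (-1 : ℝ)..1, k s := by
      simp only [hneg]
      rw [intervalIntegral.integral_sub (by simp) (hint _ _)]
      norm_num
    linarith
  refine ⟨fun t => ∫ s in (-1 : ℝ)..t, k s, ?_, ?_, ?_, ?_, ?_⟩
  · rw [contDiff_infty_iff_deriv, hd]
    exact ⟨fun t => (hderiv t).differentiableAt, hkc⟩
  · intro t ht
    have : ∀ s ∈ uIcc (-1 : ℝ) t, k s = (fun _ => (0 : ℝ)) s := by
      intro s hs
      rw [uIcc_of_ge ht] at hs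
      exact Real.smoothTransition.zero_of_nonpos (by linarith [hs.2])
    show ∫ s in (-1 : ℝ)..t, k s = 0
    rw [intervalIntegral.integral_congr this]
    simp
  · intro t ht
    have : ∀ s ∈ uIcc (1 : ℝ) t, k s = (fun _ => (1 : ℝ)) s := by
      intro s hs
      rw [uIcc_of_le ht] at hs
      exact Real.smoothTransition.one_of_one_le (by linarith [hs.1])
    show ∫ s in (-1 : ℝ)..t, k s = t
    rw [← intervalIntegral.integral_add_adjacent_intervals (hint (-1) 1) (hint 1 t), hone,
      intervalIntegral.integral_congr this]
    simp
  · intro t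
    rw [hd]
    exact ⟨Real.smoothTransition.nonneg _, Real.smoothTransition.le_one _⟩
  · intro t
    rw [hd]
    refine Monotone.deriv_nonneg fun a b hab => Real.smoothTransition.monotone ?_
    linarith

/-- A smooth convex function equal to `max t 0` outside of `[-δ, δ]`, whose deviation from
homogeneity is at most `δ`. -/
theorem exists_regularized_max {δ : ℝ} (hδ : 0 < δ) : ∃ h : ℝ → ℝ, ContDiff ℝ ∞ h ∧
    (∀ t ≤ -δ, h t = 0) ∧ (∀ t, δ ≤ t → h t = t) ∧ (∀ t, 0 ≤ deriv h t ∧ deriv h t ≤ 1) ∧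
    (∀ t, 0 ≤ deriv (deriv h) t) ∧ ∀ t, |h t - t * deriv h t| ≤ δ := by
  obtain ⟨h, hc, h0, h1, hd, hdd⟩ := exists_unit_regularized_max
  have hdiff : Differentiable ℝ h := hc.differentiable (by simp)
  have hmono : Monotone (deriv h) := monotone_of_deriv_nonneg
    ((contDiff_infty_iff_deriv.1 hc).2.differentiable (by simp)) hdd
  -- The deviation vanishes where `h` is locally `0` or the identity, so only the compact interval
  -- `[-1, 1]` matters.
  obtain ⟨C, hC0, hC⟩ : ∃ C, 0 < C ∧ ∀ t, |h t - t * deriv h t| ≤ C := by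
    have hcont : Continuous fun t => h t - t * deriv h t :=
      hc.continuous.sub (continuous_id.mul (contDiff_infty_iff_deriv.1 hc).2.continuous)
    obtain ⟨C, hC⟩ := (isCompact_Icc (a := (-1 : ℝ)) (b := 1)).exists_bound_of_continuousOn
      hcont.continuousOn
    refine ⟨max C 1, by positivity, fun t => ?_⟩
    rcases lt_or_ge t (-1) with ht | ht
    · have e : h =ᶠ[𝓝 t] fun _ => 0 := by
        filter_upwards [Iio_mem_nhds ht] with s hs using h0 s (le_of_lt hs)
      rw [e.deriv_eq, h0 t ht.le]
      simp
    rcases le_or_gt t 1 with ht' | ht'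
    · exact (hC t ⟨ht, ht'⟩).trans (le_max_left _ _)
    · have e : h =ᶠ[𝓝 t] fun s => s := by
        filter_upwards [Ioi_mem_nhds ht'] with s hs using h1 s (le_of_lt hs)
      rw [e.deriv_eq, h1 t ht'.le]
      simp
  -- Replacing `h` by `r h(t / r)` keeps the slopes in `[0, 1]`, shrinks the transition interval to
  -- `[-r, r]` and multiplies the deviation by `r`.
  set r := min δ (δ / C) with hr
  have hr0 : 0 < r := lt_min hδ (div_pos hδ hC0)
  have hrδ : r ≤ δ := min_le_left _ _
  have hrC : r * C ≤ δ := by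
    calc r * C ≤ δ / C * C := by gcongr; exact min_le_right _ _
      _ = δ := div_mul_cancel₀ _ hC0.ne'
  have hdh : ∀ t, HasDerivAt (fun t => r * h (t / r)) (deriv h (t / r)) t := by
    intro t
    have := ((hdiff (t / r)).hasDerivAt.comp t ((hasDerivAt_id t).div_const r)).const_mul r
    convert! this using 1
    field_simp
  have hdeq : deriv (fun t => r * h (t / r)) = fun t => deriv h (t / r) :=
    funext fun t => (hdh t).deriv
  refine ⟨fun t => r * h (t / r), ?_, ?_, ?_, ?_, ?_, ?_⟩
  · exact contDiff_const.mul (hc.comp (contDiff_id.div_const r))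
  · intro t ht
    show r * h (t / r) = 0
    rw [h0 _ (by rw [div_le_iff₀ hr0]; linarith), mul_zero]
  · intro t ht
    show r * h (t / r) = t
    rw [h1 _ (by rw [le_div_iff₀ hr0]; linarith)]
    field_simp
  · intro t
    rw [hdeq]
    exact hd _
  · intro t
    rw [hdeq]
    exact Monotone.deriv_nonneg fun a b hab => hmono (by gcongr)
  · intro t
    rw [hdeq]
    have e : r * h (t / r) - t * deriv h (t / r) =
        r * (h (t / r) - (t / r) * deriv h (t / r)) := by field_simp
    show |r * h (t / r) - t * deriv h (t / r)| ≤ δ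
    rw [e, abs_mul, abs_of_pos hr0]
    exact (mul_le_mul_of_nonneg_left (hC _) hr0.le).trans hrC

end RegularizedMax

/-! ### Sign comparison of two functions increasing along a common direction. -/

section Crossing

variable {E : Type*} [NormedAddCommGroup E] [NormedSpace ℝ E] {r t : E → ℝ} {y₀ X : E}

theorem eventually_fderiv_apply_pos (hr : ContDiffAt ℝ 1 r y₀) (h : 0 < fderiv ℝ r y₀ X) :
    ∀ᶠ y in 𝓝 y₀, DifferentiableAt ℝ r y ∧ 0 < fderiv ℝ r y X := by
  have h1 : ContinuousAt (fun y => fderiv ℝ r y X) y₀ :=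
    (hr.fderiv_right (m := 0) (by simp)).continuousAt.clm_apply continuousAt_const
  filter_upwards [hr.eventually (by simp), h1.eventually (lt_mem_nhds h)] with y a b
  exact ⟨a.differentiableAt (by simp), b⟩

/-- Otherwise `y` would be a local maximum, with zero derivative. Hence a zero of a defining
function cannot be interior to `{r ≤ 0}`. -/
theorem frequently_pos_of_fderiv_apply_pos {y : E} (hy : r y = 0) (h : 0 < fderiv ℝ r y X) :
    ∃ᶠ z in 𝓝 y, 0 < r z := by
  intro hn
  have hmax : IsLocalMax r y := by
    filter_upwards [hn] with z hz
    rw [hy]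
    exact not_lt.1 hz
  rw [hmax.fderiv_eq_zero] at h
  simp at h

/-- If `t` vanishes on the zero set of `r`, and both increase along `X`, then `t` has the same
sign as `r`. -/
theorem eventually_sign_eq (hr : ContDiffAt ℝ 1 r y₀) (ht : ContDiffAt ℝ 1 t y₀)
    (hrX : 0 < fderiv ℝ r y₀ X) (htX : 0 < fderiv ℝ t y₀ X) (h0 : r y₀ = 0)
    (hrt : ∀ᶠ y in 𝓝 y₀, r y = 0 → t y = 0) :
    ∀ᶠ y in 𝓝 y₀, (0 < r y → 0 < t y) ∧ (r y < 0 → t y < 0) := by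
  obtain ⟨ε, hε, hball⟩ := Metric.eventually_nhds_iff_ball.1
    ((eventually_fderiv_apply_pos hr hrX).and ((eventually_fderiv_apply_pos ht htX).and hrt))
  obtain ⟨c, hc0, hc⟩ : ∃ c : ℝ, 0 < c ∧ c * ‖X‖ < ε / 2 := by
    refine ⟨ε / 2 / (‖X‖ + 1), by positivity, ?_⟩
    rw [div_mul_eq_mul_div, div_lt_iff₀ (by positivity)]
    nlinarith [norm_nonneg X]
  have hmem : ∀ y ∈ Metric.ball y₀ (ε / 2), ∀ s ∈ Icc (-c) c, y + s • X ∈ Metric.ball y₀ ε := by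
    intro y hy s hs
    rw [mem_ball_iff_norm] at hy ⊢
    have : ‖s • X‖ ≤ c * ‖X‖ := by
      rw [norm_smul]
      gcongr
      exact abs_le.2 hs
    calc ‖y + s • X - y₀‖ = ‖(y - y₀) + s • X‖ := by congr 1; abel
      _ ≤ ‖y - y₀‖ + ‖s • X‖ := norm_add_le _ _
      _ < ε := by linarith
  have hline : ∀ (f : E → ℝ), (∀ y ∈ Metric.ball y₀ ε, DifferentiableAt ℝ f y ∧
      0 < fderiv ℝ f y X) → ∀ y ∈ Metric.ball y₀ (ε / 2),
      ContinuousOn (fun s : ℝ => f (y + s • X)) (Icc (-c) c) ∧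
      StrictMonoOn (fun s : ℝ => f (y + s • X)) (Icc (-c) c) := by
    intro f hf y hy
    have hder : ∀ s ∈ Icc (-c) c, HasDerivAt (fun s : ℝ => f (y + s • X))
        (fderiv ℝ f (y + s • X) X) s := by
      intro s hs
      have h1 : HasDerivAt (fun s : ℝ => y + s • X) X s := by
        simpa using ((hasDerivAt_id s).smul_const X).const_add y
      exact (hf _ (hmem y hy s hs)).1.hasFDerivAt.comp_hasDerivAt s h1
    have hcont : ContinuousOn (fun s : ℝ => f (y + s • X)) (Icc (-c) c) :=
      fun s hs => (hder s hs).continuousAt.continuousWithinAt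
    refine ⟨hcont, strictMonoOn_of_deriv_pos (convex_Icc _ _) hcont fun s hs => ?_⟩
    have hs' := interior_subset hs
    rw [(hder s hs').deriv]
    exact (hf _ (hmem y hy s hs')).2
  have hrl := hline r fun y hy => (hball y hy).1
  have htl := hline t fun y hy => (hball y hy).2.1
  have hy₀ : y₀ ∈ Metric.ball y₀ (ε / 2) := Metric.mem_ball_self (by positivity)
  have m0 : (0 : ℝ) ∈ Icc (-c) c := ⟨by linarith, hc0.le⟩
  have mc : c ∈ Icc (-c) c := ⟨by linarith, le_rfl⟩
  have mc' : -c ∈ Icc (-c) c := ⟨le_rfl, by linarith⟩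
  have hpos : 0 < r (y₀ + c • X) := by
    have := (hrl y₀ hy₀).2 m0 mc hc0
    simpa [h0] using this
  have hneg : r (y₀ + (-c) • X) < 0 := by
    have := (hrl y₀ hy₀).2 mc' m0 (by linarith)
    simpa [h0] using this
  have hcontc : ∀ s ∈ Icc (-c) c, ContinuousAt (fun y => r (y + s • X)) y₀ := by
    intro s hs
    exact ContinuousAt.comp (g := r) (hball _ (hmem y₀ hy₀ s hs)).1.1.continuousAt
      (continuousAt_id.add continuousAt_const)
  filter_upwards [(hcontc c mc).eventually (lt_mem_nhds hpos),
    (hcontc (-c) mc').eventually (gt_mem_nhds hneg),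
    Metric.ball_mem_nhds y₀ (half_pos hε)] with y hyp hyn hyb
  -- The segment through `y` in direction `X` crosses the zero set of `r`, where `t` vanishes too.
  -- Both functions are strictly increasing on it, so the position of the crossing relative to `y`
  -- determines both signs.
  obtain ⟨s, hs, hs0⟩ : (0 : ℝ) ∈ (fun s : ℝ => r (y + s • X)) '' Icc (-c) c :=
    intermediate_value_Icc (by linarith) (hrl y hyb).1 ⟨hyn.le, hyp.le⟩
  have ht0 : t (y + s • X) = 0 := (hball _ (hmem y hyb s hs)).2.2 hs0
  have hs0' : r (y + s • X) = 0 := hs0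
  constructor
  · intro hry
    have hlt : s < 0 := ((hrl y hyb).2.lt_iff_lt hs m0).1 (by simpa [hs0'] using hry)
    have := (htl y hyb).2 hs m0 hlt
    simpa [ht0] using this
  · intro hry
    have hlt : 0 < s := ((hrl y hyb).2.lt_iff_lt m0 hs).1 (by simpa [hs0'] using hry)
    have := (htl y hyb).2 m0 hs hlt
    simpa [ht0] using this

end Crossing

/-! ### The sign of a function near the boundary of `D`. -/

section Boundary

variable {E : Type*} [NormedAddCommGroup E] [NormedSpace ℂ E]
  {M : Type*} [TopologicalSpace M] [ChartedSpace E M] {D : Set M} {p : M} {X : E} {t r : M → ℝ}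

theorem lieD_eq_fderiv {f : M → ℝ} (hf : ContMDiffAt 𝓘(ℝ, E) 𝓘(ℝ, ℝ) ∞ f p) (v : E) :
    lieD f p v = fderiv ℝ (f ∘ (extChartAt 𝓘(ℝ, E) p).symm) (extChartAt 𝓘(ℝ, E) p p) v := by
  have h := (hf.mdifferentiableAt (by simp)).mfderiv
  simp only [modelWithCornersSelf_coe, range_id, fderivWithin_univ] at h
  exact congrArg (fun L : E →L[ℝ] ℝ => L v) h

variable [IsManifold 𝓘(ℝ, E) ∞ M]

theorem lieD_sub {f g : M → ℝ} (hf : ContMDiffAt 𝓘(ℝ, E) 𝓘(ℝ, ℝ) ∞ f p)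
    (hg : ContMDiffAt 𝓘(ℝ, E) 𝓘(ℝ, ℝ) ∞ g p) (v : E) :
    lieD (fun x => f x - g x) p v = lieD f p v - lieD g p v := by
  have hy := mem_extChartAt_target (I := 𝓘(ℝ, E)) p
  have hfy := (contDiffAt_comp_chart_symm hy
    (by rwa [extChartAt_to_inv])).differentiableAt (f := f ∘ _) (by simp)
  have hgy := (contDiffAt_comp_chart_symm hy
    (by rwa [extChartAt_to_inv])).differentiableAt (f := g ∘ _) (by simp)
  rw [lieD_eq_fderiv hf, lieD_eq_fderiv hg, lieD_eq_fderiv (hf.sub hg)]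
  exact congrArg (fun L : E →L[ℝ] ℝ => L v) (fderiv_sub hfy hgy)

/-- A function vanishing on the boundary of `D` and increasing in an outward direction is positive
outside of `D` and negative inside of `D`, near the boundary. -/
theorem eventually_sign_near_boundary (hD : IsClosed D) (hp : p ∈ frontier D)
    (hr : IsDefiningFunctionAt E D p r) (hrX : 0 < lieD r p X)
    (ht : ContMDiffAt 𝓘(ℝ, E) 𝓘(ℝ, ℝ) ∞ t p) (htX : 0 < lieD t p X)
    (h0 : ∀ᶠ x in 𝓝 p, x ∈ frontier D → t x = 0) :
    ∀ᶠ x in 𝓝 p, (x ∉ D → 0 < t x) ∧ (x ∈ interior D → t x < 0) := by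
  obtain ⟨⟨W, hWo, hpW, hrW, hWD⟩, -⟩ := hr
  have hrp : ContMDiffAt 𝓘(ℝ, E) 𝓘(ℝ, ℝ) ∞ r p := hrW.contMDiffAt (hWo.mem_nhds hpW)
  have hpD : p ∈ D := hD.frontier_subset hp
  have hrp0 : r p = 0 := by
    refine le_antisymm ((hWD p hpW).1 hpD) (not_lt.1 fun hlt => hp.2 ?_)
    rw [mem_interior_iff_mem_nhds]
    filter_upwards [hrp.continuousAt.eventually (gt_mem_nhds hlt), hWo.mem_nhds hpW] with x hx hxW
    exact (hWD x hxW).2 hx.le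
  set y₀ := extChartAt 𝓘(ℝ, E) p p with hy₀
  have hy₀t : y₀ ∈ (extChartAt 𝓘(ℝ, E) p).target := mem_extChartAt_target p
  have hsy₀ : (extChartAt 𝓘(ℝ, E) p).symm y₀ = p := extChartAt_to_inv p
  have hrc : ContDiffAt ℝ 1 (r ∘ (extChartAt 𝓘(ℝ, E) p).symm) y₀ :=
    (contDiffAt_comp_chart_symm hy₀t (by rwa [hsy₀])).of_le (by simp)
  have htc : ContDiffAt ℝ 1 (t ∘ (extChartAt 𝓘(ℝ, E) p).symm) y₀ :=
    (contDiffAt_comp_chart_symm hy₀t (by rwa [hsy₀])).of_le (by simp)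
  rw [lieD_eq_fderiv hrp] at hrX
  rw [lieD_eq_fderiv ht] at htX
  have hsymm : Tendsto (extChartAt 𝓘(ℝ, E) p).symm (𝓝 y₀) (𝓝 p) := by
    have := continuousAt_extChartAt_symm'' hy₀t
    rwa [ContinuousAt, hsy₀] at this
  have hfront : ∀ᶠ y in 𝓝 y₀, (r ∘ (extChartAt 𝓘(ℝ, E) p).symm) y = 0 →
      (extChartAt 𝓘(ℝ, E) p).symm y ∈ frontier D := by
    filter_upwards [eventually_fderiv_apply_pos hrc hrX,
      hsymm.eventually (hWo.mem_nhds hpW), chart_target_mem_nhds hy₀t] with y hy hyW hyt hy0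
    refine ⟨subset_closure ((hWD _ hyW).2 hy0.le), fun hint => ?_⟩
    have hc : ContinuousAt (extChartAt 𝓘(ℝ, E) p).symm y := continuousAt_extChartAt_symm'' hyt
    refine frequently_pos_of_fderiv_apply_pos hy0 hy.2 ?_
    filter_upwards [hc.eventually (mem_interior_iff_mem_nhds.1 hint),
      hc.eventually (hWo.mem_nhds hyW)] with z hzD hzW
    exact not_lt.2 ((hWD _ hzW).1 hzD)
  have hsign := eventually_sign_eq hrc htc hrX htX (by rwa [Function.comp_apply, hsy₀]) (by
    filter_upwards [hfront, hsymm.eventually h0] with y hy hy' hy0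
    exact hy' (hy hy0))
  have hchart : Tendsto (extChartAt 𝓘(ℝ, E) p) (𝓝 p) (𝓝 y₀) := continuousAt_extChartAt p
  filter_upwards [hchart.eventually hsign, hchart.eventually hfront, hWo.mem_nhds hpW,
    extChartAt_source_mem_nhds (I := 𝓘(ℝ, E)) p] with x hx hxf hxW hxs
  simp only [Function.comp_apply, (extChartAt 𝓘(ℝ, E) p).left_inv hxs] at hx hxf
  refine ⟨fun hxD => hx.1 (not_le.1 fun hle => hxD ((hWD x hxW).2 hle)), fun hxD => hx.2 ?_⟩
  refine lt_of_le_of_ne ((hWD x hxW).1 (interior_subset hxD)) fun hx0 => ?_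
  exact (hxf hx0).2 hxD

end Boundary

/-! ### Uniform domination of one form by a positive one on compact sets. -/

section Domination

variable {E : Type*} [NormedAddCommGroup E] [NormedSpace ℂ E]

theorem form_two_smul_apply (a : E [⋀^Fin 2]→L[ℝ] ℝ) (c : ℝ) (v : E) :
    a ![complexJ E (c • v), c • v] = c ^ 2 * a ![complexJ E v, v] := by
  have : (![complexJ E (c • v), c • v] : Fin 2 → E) = fun i => c • ![complexJ E v, v] i := by
    ext i
    fin_cases i <;> simp
  rw [this]
  have h := a.toMultilinearMap.map_smul_univ (fun _ => c) ![complexJ E v, v]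
  simpa using h

variable [FiniteDimensional ℂ E]

theorem eventually_dominates {A R : E → E [⋀^Fin 2]→L[ℝ] ℝ} {y₀ : E} (hA : ContinuousAt A y₀)
    (hR : ContinuousAt R y₀) (hpos : ∀ v ≠ 0, 0 < A y₀ ![complexJ E v, v]) :
    ∃ ε > 0, ∀ᶠ y in 𝓝 y₀, ∀ v ≠ 0,
      ε * |R y ![complexJ E v, v]| < A y ![complexJ E v, v] := by
  have : ProperSpace E := FiniteDimensional.proper ℂ E
  have hvec : Continuous fun v : E => (![complexJ E v, v] : Fin 2 → E) := by
    refine continuous_pi fun i => ?_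
    fin_cases i
    · exact (complexJ E).continuous
    · exact continuous_id
  -- The factor `ε` is treated as a variable near `0`: at `ε = 0` the strict inequality is
  -- positivity of `A`, and compactness of the unit sphere makes it uniform in `v`. Homogeneity of
  -- degree two then covers all `v ≠ 0`.
  have key : ∀ᶠ q : ℝ × E in 𝓝 (0, y₀), ∀ v ∈ Metric.sphere (0 : E) 1,
      q.1 * |R q.2 ![complexJ E v, v]| < A q.2 ![complexJ E v, v] := by
    refine (isCompact_sphere (0 : E) 1).eventually_forall_of_forall_eventually fun v hv => ?_
    have hv0 : v ≠ 0 := by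
      rintro rfl
      simp at hv
    have hev : ∀ B : E → E [⋀^Fin 2]→L[ℝ] ℝ, ContinuousAt B y₀ →
        ContinuousAt (fun z : (ℝ × E) × E => B z.1.2 ![complexJ E z.2, z.2]) ((0, y₀), v) := by
      intro B hB
      have h1 : ContinuousAt (fun z : (ℝ × E) × E => B z.1.2) ((0, y₀), v) :=
        ContinuousAt.comp (g := B) hB (continuousAt_snd.comp continuousAt_fst)
      exact h1.eval (hvec.continuousAt.comp continuousAt_snd)
    have hleft : ContinuousAt (fun z : (ℝ × E) × E => z.1.1 * |R z.1.2 ![complexJ E z.2, z.2]|)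
        ((0, y₀), v) :=
      (continuousAt_fst.comp continuousAt_fst).mul (hev R hR).abs
    exact hleft.eventually_lt (hev A hA) (by simpa using hpos v hv0)
  obtain ⟨ε, h, hε⟩ := ((key.curry_nhds.filter_mono nhdsWithin_le_nhds).and
    (self_mem_nhdsWithin : Ioi (0 : ℝ) ∈ 𝓝[>] 0)).exists
  refine ⟨ε, hε, ?_⟩
  filter_upwards [h] with y hy v hv
  have hn : 0 < ‖v‖ := norm_pos_iff.2 hv
  have hs := hy (‖v‖⁻¹ • v) (by simp [norm_smul, hn.ne'])
  rw [form_two_smul_apply, form_two_smul_apply, abs_mul, abs_of_pos (by positivity)] at hs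
  have hc : 0 < ‖v‖⁻¹ ^ 2 := by positivity
  refine lt_of_mul_lt_mul_left ?_ hc.le
  linarith

variable {M : Type*} [TopologicalSpace M] [ChartedSpace E M] [IsManifold 𝓘(ℂ, E) ω M]

/-- The estimate is transported through the chart, whose inverse has an invertible derivative
commuting with `I`. -/
theorem eventually_assocMetric_dominates {A R : DForm E M 2} {p : M}
    (hA : ContinuousAt (A.inChart p) (extChartAt 𝓘(ℝ, E) p p))
    (hR : ContinuousAt (R.inChart p) (extChartAt 𝓘(ℝ, E) p p))
    (hpos : ∀ v : E, v ≠ 0 → 0 < assocMetric A p v v) :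
    ∃ ε > 0, ∀ᶠ x in 𝓝 p, ∀ v : E, v ≠ 0 →
      ε * |assocMetric R x v v| < assocMetric A x v v := by
  obtain ⟨ε, hε, h⟩ := eventually_dominates hA hR (by rwa [A.inChart_self])
  refine ⟨ε, hε, ?_⟩
  have hc : ContinuousAt (extChartAt 𝓘(ℝ, E) p) p := continuousAt_extChartAt p
  filter_upwards [hc.eventually h, extChartAt_source_mem_nhds (I := 𝓘(ℝ, E)) p] with x hx hxs v hv
  have hy : extChartAt 𝓘(ℝ, E) p x ∈ (extChartAt 𝓘(ℝ, E) p).target :=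
    (extChartAt 𝓘(ℝ, E) p).map_source hxs
  obtain ⟨L, -, hL⟩ := chartInvDeriv_left_inv hy
  have hLv : chartInvDeriv p (extChartAt 𝓘(ℝ, E) p x) (L v) = v :=
    congrArg (fun T : E →L[ℝ] E => T v) hL
  have hL0 : L v ≠ 0 := by
    intro h0
    rw [h0, map_zero] at hLv
    exact hv hLv.symm
  have heval : ∀ B : DForm E M 2, B.inChart p (extChartAt 𝓘(ℝ, E) p x) ![complexJ E (L v), L v] =
      assocMetric B x v v := by
    intro B
    rw [DForm.inChart, ContinuousAlternatingMap.compContinuousLinearMap_apply,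
      (extChartAt 𝓘(ℝ, E) p).left_inv hxs, assocMetric]
    congr 1
    ext i
    fin_cases i
    · exact (chartInvDeriv_complexJ hy (L v)).trans (congrArg (complexJ E) hLv)
    · exact hLv
  have := hx (L v) hL0
  rwa [heval, heval] at this

theorem exists_dominates_on_compact {A R : DForm E M 2} {N : Set M} (hN : IsCompact N)
    (hA : ∀ p ∈ N, ContinuousAt (A.inChart p) (extChartAt 𝓘(ℝ, E) p p))
    (hR : ∀ p ∈ N, ContinuousAt (R.inChart p) (extChartAt 𝓘(ℝ, E) p p))
    (hpos : IsPositiveOn A N) :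
    ∃ ε > 0, ∀ x ∈ N, ∀ v : E, v ≠ 0 → ε * |assocMetric R x v v| < assocMetric A x v v := by
  refine hN.induction_on (p := fun S => ∃ ε > 0, ∀ x ∈ S, ∀ v : E, v ≠ 0 →
    ε * |assocMetric R x v v| < assocMetric A x v v) ⟨1, one_pos, by simp⟩ ?_ ?_ ?_
  · rintro s t hst ⟨ε, hε, h⟩
    exact ⟨ε, hε, fun x hx => h x (hst hx)⟩
  · rintro s t ⟨ε, hε, h⟩ ⟨ε', hε', h'⟩
    refine ⟨min ε ε', lt_min hε hε', ?_⟩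
    rintro x (hx | hx) v hv
    · exact (mul_le_mul_of_nonneg_right (min_le_left _ _) (abs_nonneg _)).trans_lt (h x hx v hv)
    · exact (mul_le_mul_of_nonneg_right (min_le_right _ _) (abs_nonneg _)).trans_lt (h' x hx v hv)
  · intro p hp
    obtain ⟨ε, hε, h⟩ := eventually_assocMetric_dominates (hA p hp) (hR p hp) (hpos p hp)
    exact ⟨_, mem_nhdsWithin_of_mem_nhds h, ε, hε, fun x hx => hx⟩

end Domination

/-! ### Gluing potentials, then LCK forms. -/

section Gluing

variable {E : Type*} [NormedAddCommGroup E] [NormedSpace ℂ E]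
  {M : Type*} [TopologicalSpace M] [ChartedSpace E M]
  {θ : DForm E M 1} {φ ψ : M → ℝ} {x : M}

theorem eventually_contMDiffAt {f : M → ℝ} {V : Set M} (hV : IsOpen V)
    (hf : ContMDiffOn 𝓘(ℝ, E) 𝓘(ℝ, ℝ) ∞ f V) (hx : x ∈ V) :
    ∀ᶠ q in 𝓝 x, ContMDiffAt 𝓘(ℝ, E) 𝓘(ℝ, ℝ) ∞ f q := by
  filter_upwards [hV.mem_nhds hx] with q hq using hf.contMDiffAt (hV.mem_nhds hq)

theorem contMDiffAt_glue {h : ℝ → ℝ} (hh : ContDiff ℝ ∞ h)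
    (hφ : ContMDiffAt 𝓘(ℝ, E) 𝓘(ℝ, ℝ) ∞ φ x) (hψ : ContMDiffAt 𝓘(ℝ, E) 𝓘(ℝ, ℝ) ∞ ψ x) :
    ContMDiffAt 𝓘(ℝ, E) 𝓘(ℝ, ℝ) ∞ (fun q => ψ q + h (φ q - ψ q)) x :=
  hψ.add (hh.contMDiff.contMDiffAt.comp x (hφ.sub hψ))

variable [IsManifold 𝓘(ℂ, E) ω M]

/-- Positivity of `d_θ d^c_θ` of a regularized maximum of two plurisubharmonic functions. -/
theorem assocMetric_glue_pos (hθ : θ.Smooth)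
    (hφ : ∀ᶠ q in 𝓝 x, ContMDiffAt 𝓘(ℝ, E) 𝓘(ℝ, ℝ) ∞ φ q)
    (hψ : ∀ᶠ q in 𝓝 x, ContMDiffAt 𝓘(ℝ, E) 𝓘(ℝ, ℝ) ∞ ψ q)
    {h : ℝ → ℝ} (hh : ContDiff ℝ ∞ h) (hd : ∀ t, 0 ≤ deriv h t ∧ deriv h t ≤ 1)
    (hdd : ∀ t, 0 ≤ deriv (deriv h) t) {δ : ℝ} (herr : ∀ t, |h t - t * deriv h t| ≤ δ) (v : E)
    (h1 : δ * |assocMetric (ddcTheta θ fun _ => 1) x v v| < assocMetric (ddcTheta θ φ) x v v)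
    (h2 : δ * |assocMetric (ddcTheta θ fun _ => 1) x v v| < assocMetric (ddcTheta θ ψ) x v v) :
    0 < assocMetric (ddcTheta θ fun q => ψ q + h (φ q - ψ q)) x v v := by
  have hx := mem_extChartAt_target (I := 𝓘(ℝ, E)) x
  have hF : ∀ᶠ q in 𝓝 x, ContMDiffAt 𝓘(ℝ, E) 𝓘(ℝ, ℝ) ∞ (fun q => ψ q + h (φ q - ψ q)) q := by
    filter_upwards [hφ, hψ] with q a b using contMDiffAt_glue hh a b
  have hone : ∀ᶠ q in 𝓝 x, ContMDiffAt 𝓘(ℝ, E) 𝓘(ℝ, ℝ) ∞ (fun _ => (1 : ℝ)) q :=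
    Eventually.of_forall fun q => contMDiffAt_const
  have hφx := contDiffAt_comp_chart_symm hx (by rw [extChartAt_to_inv]; exact hφ.self_of_nhds)
  have hψx := contDiffAt_comp_chart_symm hx (by rw [extChartAt_to_inv]; exact hψ.self_of_nhds)
  have key := flatDdc_glue_apply (hθ.contDiffAt hx) hφx hψx hh v
  rw [assocMetric, ddcTheta_apply hθ hone] at h1 h2
  rw [assocMetric, ddcTheta_apply hθ hφ] at h1
  rw [assocMetric, ddcTheta_apply hθ hψ] at h2
  rw [assocMetric, ddcTheta_apply hθ hF]
  refine lt_of_lt_of_eq ?_ key.symm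
  generalize (φ ∘ (extChartAt 𝓘(ℝ, E) x).symm) (extChartAt 𝓘(ℝ, E) x x)
    - (ψ ∘ (extChartAt 𝓘(ℝ, E) x).symm) (extChartAt 𝓘(ℝ, E) x x) = s
  have hone' : ((fun _ : M => (1 : ℝ)) ∘ (extChartAt 𝓘(ℝ, E) x).symm) = fun _ => (1 : ℝ) := rfl
  rw [hone'] at h1 h2
  set R := flatDdc (θ.inChart x) (fun _ => 1) (extChartAt 𝓘(ℝ, E) x x) ![complexJ E v, v]
  set A := flatDdc (θ.inChart x) (φ ∘ (extChartAt 𝓘(ℝ, E) x).symm) (extChartAt 𝓘(ℝ, E) x x)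
    ![complexJ E v, v]
  set B := flatDdc (θ.inChart x) (ψ ∘ (extChartAt 𝓘(ℝ, E) x).symm) (extChartAt 𝓘(ℝ, E) x x)
    ![complexJ E v, v]
  have hsq := mul_nonneg (hdd s) (add_nonneg
    (sq_nonneg (fderiv ℝ (φ ∘ (extChartAt 𝓘(ℝ, E) x).symm) (extChartAt 𝓘(ℝ, E) x x) (complexJ E v)
      - fderiv ℝ (ψ ∘ (extChartAt 𝓘(ℝ, E) x).symm) (extChartAt 𝓘(ℝ, E) x x) (complexJ E v)))
    (sq_nonneg (fderiv ℝ (φ ∘ (extChartAt 𝓘(ℝ, E) x).symm) (extChartAt 𝓘(ℝ, E) x x) v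
      - fderiv ℝ (ψ ∘ (extChartAt 𝓘(ℝ, E) x).symm) (extChartAt 𝓘(ℝ, E) x x) v)))
  have hR : -(δ * |R|) ≤ (h s - s * deriv h s) * R := by
    refine (abs_le.1 ?_).1
    rw [abs_mul]
    exact mul_le_mul_of_nonneg_right (herr s) (abs_nonneg _)
  -- A convex combination of two quantities exceeding `δ * |R|`; the weight `h' = 0` is separate
  -- because strictness is otherwise drawn from `A`.
  have hconv : δ * |R| < deriv h s * A + (1 - deriv h s) * B := by
    rcases (hd s).1.eq_or_lt with h0 | h0
    · rw [← h0]
      linarith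
    · nlinarith [mul_lt_mul_of_pos_left h1 h0,
        mul_le_mul_of_nonneg_left h2.le (sub_nonneg.2 (hd s).2)]
  linarith

/-- A smooth function `F` on `V` equal to `φ` outside of a closed set `K ⊆ V`, with
`d_θ d^c_θ F` positive, extends an LCK form equal to `d_θ d^c_θ φ` on `V`. -/
theorem isLCKForm_glue {Ω : DForm E M 2} (hΩ : IsLCKForm θ Ω) {V K : Set M} (hV : IsOpen V)
    (hK : IsClosed K) (hKV : K ⊆ V) (hΩφ : ∀ x ∈ V, Ω x = ddcTheta θ φ x) {F : M → ℝ}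
    (hF : IsStrictPSHOn θ F V) (hFφ : ∀ x ∈ V, x ∉ K → F x = φ x)
    {Ω₁ : DForm E M 2} (h1 : ∀ x ∈ V, Ω₁ x = ddcTheta θ F x) (h2 : ∀ x ∉ V, Ω₁ x = Ω x) :
    IsLCKForm θ Ω₁ ∧ ∀ x ∉ K, Ω₁ x = Ω x := by
  have hoff : ∀ x ∉ K, Ω₁ x = Ω x := by
    intro x hx
    by_cases hxV : x ∈ V
    · rw [h1 x hxV, hΩφ x hxV]
      refine ddcTheta_congr ?_
      filter_upwards [hV.mem_nhds hxV, hK.isOpen_compl.mem_nhds hx] with q hq hqK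
      exact hFφ q hq hqK
    · exact h2 x hxV
  have hin : ∀ x ∈ V, Ω₁ =ᶠ[𝓝 x] ddcTheta θ F := fun x hx => by
    filter_upwards [hV.mem_nhds hx] with q hq using h1 q hq
  -- A point off `V` is off the closed set `K`, so the form is unchanged on a whole neighbourhood,
  -- even at boundary points of `V`.
  have hout : ∀ x ∉ V, Ω₁ =ᶠ[𝓝 x] Ω := fun x hx => by
    filter_upwards [hK.isOpen_compl.mem_nhds fun hxK => hx (hKV hxK)] with q hq using hoff q hq
  have hsm : ∀ x ∈ V, ∀ᶠ q in 𝓝 x, ContMDiffAt 𝓘(ℝ, E) 𝓘(ℝ, ℝ) ∞ F q := fun x hx =>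
    eventually_contMDiffAt hV hF.1 hx
  refine ⟨⟨hΩ.smooth_lee, hΩ.closed_lee, fun x y hy => ?_, ?_, fun x _ v hv => ?_, ?_⟩, hoff⟩
  · refine ContDiffAt.contDiffWithinAt ?_
    by_cases hyV : (extChartAt 𝓘(ℝ, E) x).symm y ∈ V
    · exact (contDiffAt_inChart_ddcTheta hΩ.smooth_lee hy (hsm _ hyV)).congr_of_eventuallyEq
        (DForm.inChart_congr hy (hin _ hyV))
    · exact (hΩ.smooth.contDiffAt hy).congr_of_eventuallyEq
        (DForm.inChart_congr hy (hout _ hyV))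
  · funext x
    by_cases hxV : x ∈ V
    · rw [h1 x hxV, ← actI_ddcTheta hΩ.smooth_lee hΩ.closed_lee (hsm x hxV), DForm.actI,
        h1 x hxV, DForm.actI]
    · have := congrFun hΩ.oneOne x
      rw [DForm.actI] at this ⊢
      rw [h2 x hxV, this]
  · by_cases hxV : x ∈ V
    · rw [assocMetric, h1 x hxV]
      exact hF.2 x hxV v hv
    · rw [assocMetric, h2 x hxV]
      exact hΩ.positive x (mem_univ x) v hv
  · funext x
    by_cases hxV : x ∈ V
    · rw [DForm.d_congr (hin x hxV), d_ddcTheta hΩ.smooth_lee hΩ.closed_lee (hsm x hxV),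
        DForm.wedge, DForm.wedge, h1 x hxV]
    · rw [DForm.d_congr (hout x hxV), hΩ.d_eq, DForm.wedge, DForm.wedge, h2 x hxV]

variable [FiniteDimensional ℂ E] [T2Space M]

/-- If `φ - ψ` is positive outside of `D` and negative inside of `D` near the compact boundary of
`D`, then the function equal to `ψ` in `D` and to `φ` outside of `D` can be regularized near the
boundary to a strictly plurisubharmonic function. -/
theorem exists_psh_glue (hθ : θ.Smooth) {D V U : Set M} (hD : IsClosed D)
    (hcompact : IsCompact (frontier D)) (hV : IsOpen V) (hDV : D ⊆ V)
    (hφ : IsStrictPSHOn θ φ V) (hψ : IsStrictPSHOn θ ψ V) (hU : U ∈ 𝓝ˢ (frontier D))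
    (hsign : ∀ p ∈ frontier D, ∀ᶠ x in 𝓝 p,
      (x ∉ D → 0 < φ x - ψ x) ∧ (x ∈ interior D → φ x - ψ x < 0)) :
    ∃ (F : M → ℝ) (N : Set M), IsClosed N ∧ N ⊆ V ∧ N ⊆ U ∧ IsStrictPSHOn θ F V ∧
      (∀ x ∉ N, x ∈ D → F x = ψ x) ∧ (∀ x ∉ N, x ∉ D → F x = φ x) := by
  classical
  have : ProperSpace E := FiniteDimensional.proper ℂ E
  have : LocallyCompactSpace M := ChartedSpace.locallyCompactSpace E M
  obtain ⟨O, hO, hDO, hOp⟩ : ∃ O : Set M, IsOpen O ∧ frontier D ⊆ O ∧ ∀ x ∈ O, x ∈ V ∧ x ∈ U ∧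
      (x ∉ D → 0 < φ x - ψ x) ∧ (x ∈ interior D → φ x - ψ x < 0) := by
    have : ∀ᶠ x in 𝓝ˢ (frontier D), x ∈ V ∧ x ∈ U ∧
        (x ∉ D → 0 < φ x - ψ x) ∧ (x ∈ interior D → φ x - ψ x < 0) := by
      rw [eventually_nhdsSet_iff_forall]
      intro p hp
      filter_upwards [hV.mem_nhds (hDV (hD.frontier_subset hp)),
        mem_nhdsSet_iff_forall.1 hU p hp, hsign p hp] with x a b c using ⟨a, b, c⟩
    obtain ⟨O, hO, hDO, h⟩ := mem_nhdsSet_iff_exists.1 this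
    exact ⟨O, hO, hDO, fun x hx => h hx⟩
  obtain ⟨N, hN, hDN, hNO⟩ := exists_compact_between hcompact hO hDO
  have hNV : N ⊆ V := fun x hx => (hOp x (hNO hx)).1
  have hNc : IsClosed N := hN.isClosed
  have hcont : ∀ x ∈ V, ContinuousAt (fun q => φ q - ψ q) x := fun x hx =>
    (hφ.1.contMDiffAt (hV.mem_nhds hx)).continuousAt.sub
      (hψ.1.contMDiffAt (hV.mem_nhds hx)).continuousAt
  have hint : ∀ x, x ∉ interior N → x ∈ D → x ∈ interior D := by
    intro x hx hxD
    by_contra hxi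
    exact hx (hDN ⟨subset_closure hxD, hxi⟩)
  -- The boundary of `D` lies in the interior of `N`, so `φ - ψ` has no zero on the compact frontier
  -- of `N`.
  obtain ⟨δ₀, hδ₀, hδ₀N⟩ : ∃ δ₀ : ℝ, 0 < δ₀ ∧ ∀ x ∈ frontier N, δ₀ ≤ |φ x - ψ x| := by
    refine (hN.of_isClosed_subset isClosed_frontier hNc.frontier_subset).exists_forall_le' ?_ ?_
    · exact fun x hx => (hcont x (hNV (hNc.frontier_subset hx))).abs.continuousWithinAt
    · intro x hx
      have hxO := hOp x (hNO (hNc.frontier_subset hx))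
      refine abs_pos.2 ?_
      by_cases hxD : x ∈ D
      · exact (hxO.2.2.2 (hint x hx.2 hxD)).ne
      · exact (hxO.2.2.1 hxD).ne'
  have hcontForm : ∀ f : M → ℝ, (∀ x ∈ V, ∀ᶠ q in 𝓝 x, ContMDiffAt 𝓘(ℝ, E) 𝓘(ℝ, ℝ) ∞ f q) →
      ∀ p ∈ N, ContinuousAt ((ddcTheta θ f).inChart p) (extChartAt 𝓘(ℝ, E) p p) := by
    intro f hf p hp
    refine (contDiffAt_inChart_ddcTheta hθ (mem_extChartAt_target p) ?_).continuousAt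
    rw [extChartAt_to_inv]
    exact hf p (hNV hp)
  have hone : ∀ x ∈ V, ∀ᶠ q in 𝓝 x, ContMDiffAt 𝓘(ℝ, E) 𝓘(ℝ, ℝ) ∞ (fun _ : M => (1 : ℝ)) q :=
    fun x _ => Eventually.of_forall fun q => contMDiffAt_const
  have hφV : ∀ x ∈ V, ∀ᶠ q in 𝓝 x, ContMDiffAt 𝓘(ℝ, E) 𝓘(ℝ, ℝ) ∞ φ q :=
    fun x hx => eventually_contMDiffAt hV hφ.1 hx
  have hψV : ∀ x ∈ V, ∀ᶠ q in 𝓝 x, ContMDiffAt 𝓘(ℝ, E) 𝓘(ℝ, ℝ) ∞ ψ q :=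
    fun x hx => eventually_contMDiffAt hV hψ.1 hx
  obtain ⟨ε₁, hε₁, hdom₁⟩ := exists_dominates_on_compact hN (hcontForm φ hφV)
    (hcontForm _ hone) fun x hx => hφ.2 x (hNV hx)
  obtain ⟨ε₂, hε₂, hdom₂⟩ := exists_dominates_on_compact hN (hcontForm ψ hψV)
    (hcontForm _ hone) fun x hx => hψ.2 x (hNV hx)
  -- Strictness in `δ < δ₀` keeps `|φ - ψ| > δ` near the frontier of `N`, where `h` is exactly `0`
  -- or the identity and the pieces of `F` match smoothly. The bounds by `ε₁` and `ε₂` control the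
  -- error term.
  obtain ⟨δ, hδ, hδδ₀, hδ₁, hδ₂⟩ : ∃ δ : ℝ, 0 < δ ∧ δ < δ₀ ∧ δ ≤ ε₁ ∧ δ ≤ ε₂ :=
    ⟨min (δ₀ / 2) (min ε₁ ε₂), lt_min (half_pos hδ₀) (lt_min hε₁ hε₂),
      (min_le_left _ _).trans_lt (half_lt_self hδ₀), (min_le_right _ _).trans (min_le_left _ _),
      (min_le_right _ _).trans (min_le_right _ _)⟩
  obtain ⟨h, hh, hh0, hh1, hd, hdd, herr⟩ := exists_regularized_max hδ
  set F : M → ℝ := fun x => if x ∈ N then ψ x + h (φ x - ψ x) else if x ∈ D then ψ x else φ x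
    with hFdef
  have hFN : ∀ x ∈ interior N, F =ᶠ[𝓝 x] fun q => ψ q + h (φ q - ψ q) := by
    intro x hx
    filter_upwards [mem_interior_iff_mem_nhds.1 hx] with q hq
    simp [hFdef, hq]
  have hFψ : ∀ x ∈ V, x ∉ interior N → x ∈ D → F =ᶠ[𝓝 x] ψ := by
    intro x hxV hxN hxD
    have hxi := hint x hxN hxD
    have hev : ∀ᶠ q in 𝓝 x, q ∈ N → φ q - ψ q ≤ -δ := by
      by_cases hx : x ∈ N
      · have hlt : φ x - ψ x < -δ := by
          have h1 := hδ₀N x ⟨subset_closure hx, hxN⟩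
          rw [abs_of_neg ((hOp x (hNO hx)).2.2.2 hxi)] at h1
          linarith
        filter_upwards [(hcont x hxV).eventually (gt_mem_nhds hlt)] with q hq _ using hq.le
      · filter_upwards [hNc.isOpen_compl.mem_nhds hx] with q hq hq' using absurd hq' hq
    filter_upwards [hev, mem_interior_iff_mem_nhds.1 hxi] with q hq hqD
    by_cases hqN : q ∈ N
    · simp [hFdef, hqN, hh0 _ (hq hqN)]
    · simp [hFdef, hqN, hqD]
  have hFφ : ∀ x ∈ V, x ∉ interior N → x ∉ D → F =ᶠ[𝓝 x] φ := by
    intro x hxV hxN hxD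
    have hev : ∀ᶠ q in 𝓝 x, q ∈ N → δ ≤ φ q - ψ q := by
      by_cases hx : x ∈ N
      · have hlt : δ < φ x - ψ x := by
          have h1 := hδ₀N x ⟨subset_closure hx, hxN⟩
          rw [abs_of_pos ((hOp x (hNO hx)).2.2.1 hxD)] at h1
          linarith
        filter_upwards [(hcont x hxV).eventually (lt_mem_nhds hlt)] with q hq _ using hq.le
      · filter_upwards [hNc.isOpen_compl.mem_nhds hx] with q hq hq' using absurd hq' hq
    filter_upwards [hev, hD.isOpen_compl.mem_nhds hxD] with q hq hqD
    by_cases hqN : q ∈ N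
    · simp [hFdef, hqN, hh1 _ (hq hqN)]
    · have hqD' : q ∉ D := hqD
      simp [hFdef, hqN, hqD']
  refine ⟨F, N, hNc, hNV, fun x hx => (hOp x (hNO hx)).2.1, ⟨fun x hx => ?_, fun x hx v hv => ?_⟩,
    fun x hxN hxD => by simp [hFdef, hxN, hxD], fun x hxN hxD => by simp [hFdef, hxN, hxD]⟩
  · refine ContMDiffAt.contMDiffWithinAt ?_
    have hφx := (hφV x hx).self_of_nhds
    have hψx := (hψV x hx).self_of_nhds
    by_cases hxN : x ∈ interior N
    · exact (contMDiffAt_glue hh hφx hψx).congr_of_eventuallyEq (hFN x hxN)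
    by_cases hxD : x ∈ D
    · exact hψx.congr_of_eventuallyEq (hFψ x hx hxN hxD)
    · exact hφx.congr_of_eventuallyEq (hFφ x hx hxN hxD)
  · by_cases hxN : x ∈ interior N
    · rw [assocMetric, ddcTheta_congr (hFN x hxN)]
      have hN' := interior_subset hxN
      exact assocMetric_glue_pos hθ (hφV x hx) (hψV x hx) hh hd hdd herr v
        ((mul_le_mul_of_nonneg_right hδ₁ (abs_nonneg _)).trans_lt (hdom₁ x hN' v hv))
        ((mul_le_mul_of_nonneg_right hδ₂ (abs_nonneg _)).trans_lt (hdom₂ x hN' v hv))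
    by_cases hxD : x ∈ D
    · rw [assocMetric, ddcTheta_congr (hFψ x hx hxN hxD)]
      exact hψ.2 x hx v hv
    · rw [assocMetric, ddcTheta_congr (hFφ x hx hxN hxD)]
      exact hφ.2 x hx v hv

end Gluing

end LCK

end

theorem mainTheorem5 {E : Type*} [NormedAddCommGroup E] [NormedSpace ℂ E] [FiniteDimensional ℂ E]
    (hdim : 2 ≤ Module.finrank ℂ E)
    {M : Type*} [TopologicalSpace M] [T2Space M] [SecondCountableTopology M]
    [ChartedSpace E M] [IsManifold 𝓘(ℂ, E) ω M]
    (θ : LCK.DForm E M 1) (Ω : LCK.DForm E M 2) (hΩ : LCK.IsLCKForm θ Ω)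
    (D : Set M) (hD : LCK.IsDomainWithSmoothBoundary E D) (hcompact : IsCompact (frontier D))
    (V : Set M) (hV : IsOpen V) (hDV : D ⊆ V)
    (φ ψ : M → ℝ)
    (hφ : LCK.IsStrictPSHOn θ φ V) (hΩφ : ∀ x ∈ V, Ω x = LCK.ddcTheta θ φ x)
    (hψ : LCK.IsStrictPSHOn θ ψ V)
    (heq : ∀ x ∈ frontier D, ψ x = φ x)
    (X : (x : M) → TangentSpace 𝓘(ℝ, E) x)
    (hX : ∀ p ∈ frontier D, LCK.IsOutwardNormal Ω D p (X p))
    (hlie : ∀ p ∈ frontier D, LCK.lieD (E := E) ψ p (X p) < LCK.lieD (E := E) φ p (X p))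
    (U : Set M) (hU : U ∈ 𝓝ˢ (frontier D))
    (Dminus Dplus : Set M)
    (hDminus_open : IsOpen Dminus) (hDminus_sub : Dminus ⊆ D) (hDminus_U : Disjoint Dminus U)
    (hDplus_open : IsOpen Dplus) (hDplus_sub : Dplus ⊆ Dᶜ) (hDplus_U : Disjoint Dplus U) :
    ∃ Ω₁ : LCK.DForm E M 2, LCK.IsLCKForm θ Ω₁ ∧
      (∀ x ∈ Dplus, Ω₁ x = Ω x) ∧
      (∀ x ∈ Dminus, Ω₁ x = LCK.ddcTheta θ ψ x) := by
  classical
  have hDc := hD.1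
  have hsign : ∀ p ∈ frontier D, ∀ᶠ x in 𝓝 p,
      (x ∉ D → 0 < φ x - ψ x) ∧ (x ∈ interior D → φ x - ψ x < 0) := by
    intro p hp
    have hpV := hV.mem_nhds (hDV (hDc.frontier_subset hp))
    have hφp := hφ.1.contMDiffAt hpV
    have hψp := hψ.1.contMDiffAt hpV
    obtain ⟨r, hr, hrX, -⟩ := hX p hp
    refine LCK.eventually_sign_near_boundary (t := fun x => φ x - ψ x) hDc hp hr hrX
      (hφp.sub hψp) ?_ (Eventually.of_forall fun x hx => by simp [heq x hx])
    exact (sub_pos.2 (hlie p hp)).trans_eq (LCK.lieD_sub hφp hψp (X p)).symm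
  obtain ⟨F, N, hNc, hNV, hNU, hF, hFψ, hFφ⟩ := LCK.exists_psh_glue hΩ.smooth_lee hDc hcompact hV
    hDV hφ hψ hU hsign
  -- `F` may differ from `φ` throughout `D`, not only in `N`, so the modified region is `D ∪ N`,
  -- still closed and inside `V`.
  obtain ⟨hLCK, hoff⟩ := LCK.isLCKForm_glue (F := F) (K := D ∪ N) hΩ hV (hDc.union hNc)
    (union_subset hDV hNV) hΩφ hF
    (fun x _ hx => hFφ x (fun h => hx (Or.inr h)) (fun h => hx (Or.inl h)))
    (Ω₁ := fun x => if x ∈ V then LCK.ddcTheta θ F x else Ω x)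
    (fun x hx => if_pos hx) (fun x hx => if_neg hx)
  refine ⟨_, hLCK, fun x hx => hoff x ?_, fun x hx => ?_⟩
  · rintro (hxD | hxN)
    · exact hDplus_sub hx hxD
    · exact disjoint_left.1 hDplus_U hx (hNU hxN)
  · have hxV := hDV (hDminus_sub hx)
    refine (if_pos hxV).trans (LCK.ddcTheta_congr ?_)
    filter_upwards [hDminus_open.mem_nhds hx] with q hq
    exact hFψ q (fun hqN => disjoint_left.1 hDminus_U hq (hNU hqN)) (hDminus_sub hq)
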